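/- Let $X$ be a countable (finite or countably infinite) set and let $I(X)$ be the symmetric inverse semigroup on $X$: the partial injective maps $X\to X$, written on the right and composed from left to right, with zero the empty map $0$ and identity $1=\mathrm{id}_X$. For $\alpha\in I(X)$ with $\alpha\neq 0$ let $\mathbb P(\alpha)$ be the set of all $\gamma\in I(X)$ such that $\mu\alpha\gamma\neq 0$ for every $\mu\in I(X)$ with $\mu\alpha\neq 0$; let $\mathbb P(0)=\{0\}$ and $\mathbb P^1(\alpha)=\mathbb P(\alpha)\cup\{1\}$. Elements $\alpha,\beta$ are $c$-conjugate, $\alpha\sim_c\beta$, if there are $\gamma\in\mathbb P^1(\alpha)$ and $\eta\in\mathbb P^1(\beta)$ with $\alpha\gamma=\gamma\beta$ and $\beta\eta=\eta\alpha$. The following elements of $I(X)$, where the listed points $x_i$ are pairwise distinct and the map is defined only where indicated, are called basic: a cycle of length $k\ge1$ ($x_0\mapsto x_1\mapsto\cdots\mapsto x_{k-1}\mapsto x_0$); a chain of length $k\geq 1$ ($x_0\mapsto x_1\mapsto\cdots\mapsto x_k$); a double ray ($x_i\mapsto x_{i+1}$ for all $i\in\mathbb Z$); a right ray ($x_i\mapsto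 x_{i+1}$ for all $i\ge 0$); a left ray ($x_{i+1}\mapsto x_{i}$ for all $i\ge 0$). Every $\alpha\in I(X)$ is, for a unique set of basic elements whose spans (domain union image) are pairwise disjoint, the join (union) of these elements. Let $\Delta_\alpha^k$, $\Theta_\alpha^k$, $\Omega_\alpha$, $\Upsilon_\alpha$, $\Lambda_\alpha$ denote the sets of, respectively, cycles of length $k$, chains of length $k$, double rays, right rays and left rays in this decomposition of $\alpha$. Let $k_\alpha=\sup\{k\ge 1:\Theta_\alpha^k\ne\emptyset\}\in\mathbb N\cup\{\aleph_0\}$, with $k_\alpha=0$ if $\alpha$ has no chains. If $k_\alpha$ is a positive integer, let $m_\alpha=\max\{m\in\{1,\dots,k_\alpha\}:|\Theta_\alpha^m|=\aleph_0\}$, with $m_\alpha=0$ if there is no such $m$. Then for all $\alpha,\beta\in I(X)$, $\alpha\sim_c\beta$ if and only if the following conditions hold: 1. $|\Delta_\alpha^k|=|\Delta_\beta^k|$ for every integer $k\ge 1$, $|\Omega_\alpha|=|\Omega_\beta|$ and $|\Lambda_\alpha|=|\Lambda_\beta|$; 2. if $\Omega_\alpha$ is finite, then $|\Upsilon_\alpha|=|\Upsilon_\beta|$;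 3. if $\Lambda_\alpha$ is finite, then (i) $k_\alpha=k_\beta$; and (ii) if $k_\alpha$ is a positive integer, then $m_\alpha=m_\beta$ and $|\Theta_\alpha^k|=|\Theta_\beta^k|$ for every $k\in\{m_\alpha+1,\dots,k_\alpha\}$. -/

import Mathlib

open Cardinal

/-- The symmetric inverse semigroup `I(X)`: partial injective transformations of `X`
(`y ∈ α x` says that `x ∈ dom α` and `xα = y`). -/
abbrev SymInv (X : Type*) := X ≃. X

namespace SymInv

/-- `I(X)` is a monoid with zero. Functions are composed from left to right,
`x(αβ) = (xα)β`, and the zero is the empty map. -/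
instance instMonoidWithZero {X : Type*} : MonoidWithZero (SymInv X) where
  mul α β := PEquiv.trans α β
  one := PEquiv.refl X
  zero := ⊥
  mul_assoc α β γ := PEquiv.trans_assoc α β γ
  one_mul α := PEquiv.refl_trans α
  mul_one α := PEquiv.trans_refl α
  zero_mul α := PEquiv.bot_trans α
  mul_zero α := PEquiv.trans_bot α

end SymInv

/-- The set `ℙ(a)` in a semigroup `S` with zero and identity (so that `S¹ = S`):
`ℙ(0) = {0}`, and for `a ≠ 0` it consists of all `g` with `(ma)g ≠ 0` for every
`ma ∈ S¹a \ {0}`. -/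
def conjugatorSet {S : Type*} [MonoidWithZero S] (a : S) : Set S :=
  {g | (a = 0 → g = 0) ∧ (a ≠ 0 → ∀ m : S, m * a ≠ 0 → m * a * g ≠ 0)}

/-- The set `ℙ¹(a) = ℙ(a) ∪ {1}`. -/
def conjugatorSetOne {S : Type*} [MonoidWithZero S] (a : S) : Set S :=
  conjugatorSet a ∪ {1}

/-- `c`-conjugacy `a ∼c b`. -/
def CConj {S : Type*} [MonoidWithZero S] (a b : S) : Prop :=
  ∃ g ∈ conjugatorSetOne a, ∃ h ∈ conjugatorSetOne b, a * g = g * b ∧ b * h = h * a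

namespace SymInv

variable {X : Type*}

/-- The domain of `α`. -/
def dom (α : SymInv X) : Set X := {x | ∃ y, y ∈ α x}

/-- The image of `α`. -/
def im (α : SymInv X) : Set X := {y | ∃ x, y ∈ α x}

/-- The span of `α`. -/
def span (α : SymInv X) : Set X := α.dom ∪ α.im

/-- `α` and `β` are completely disjoint. -/
def CompletelyDisjoint (α β : SymInv X) : Prop := α.span ∩ β.span = ∅

/-- `δ` is a cycle `(x₀ x₁ … x_{k-1})` of length `k ≥ 1`. -/
def IsCycle (k : ℕ) (δ : SymInv X) : Prop :=
  1 ≤ k ∧ ∃ x : ℕ → X, Set.InjOn x (Set.Iio k) ∧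
    ∀ a b : X, b ∈ δ a ↔ ∃ i < k, x i = a ∧ x ((i + 1) % k) = b

/-- `θ` is a chain `[x₀ x₁ … x_k]` of length `k ≥ 1`. -/
def IsChain (k : ℕ) (θ : SymInv X) : Prop :=
  1 ≤ k ∧ ∃ x : ℕ → X, Set.InjOn x (Set.Iic k) ∧
    ∀ a b : X, b ∈ θ a ↔ ∃ i < k, x i = a ∧ x (i + 1) = b

/-- `ω` is a double ray `⟨… x₋₁ x₀ x₁ …⟩`. -/
def IsDoubleRay (ω : SymInv X) : Prop :=
  ∃ x : ℤ → X, Function.Injective x ∧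
    ∀ a b : X, b ∈ ω a ↔ ∃ i, x i = a ∧ x (i + 1) = b

/-- `υ` is a right ray `[x₀ x₁ x₂ …⟩`. -/
def IsRightRay (υ : SymInv X) : Prop :=
  ∃ x : ℕ → X, Function.Injective x ∧
    ∀ a b : X, b ∈ υ a ↔ ∃ i, x i = a ∧ x (i + 1) = b

/-- `l` is a left ray `⟨… x₂ x₁ x₀]`. -/
def IsLeftRay (l : SymInv X) : Prop :=
  ∃ x : ℕ → X, Function.Injective x ∧
    ∀ a b : X, b ∈ l a ↔ ∃ i, x (i + 1) = a ∧ x i = b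

/-- Basic partial injective transformations. -/
def IsBasic (η : SymInv X) : Prop :=
  (∃ k, IsCycle k η) ∨ (∃ k, IsChain k η) ∨ IsDoubleRay η ∨ IsRightRay η ∨ IsLeftRay η

/-- `D` is the set of terms of a cycle-chain-ray decomposition of `α`: a set of pairwise
completely disjoint basic transformations whose join is `α`. (There is exactly one such `D`;
for `α = 0` it is empty.) -/
def IsDecomposition (α : SymInv X) (D : Set (SymInv X)) : Prop :=
  (∀ η ∈ D, IsBasic η) ∧ D.Pairwise CompletelyDisjoint ∧
    ∀ a b : X, b ∈ α a ↔ ∃ η ∈ D, b ∈ η a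

/-- `η` is contained in `α`, that is, it occurs in the cycle-chain-ray decomposition of `α`. -/
def Contains (α η : SymInv X) : Prop := ∃ D, IsDecomposition α D ∧ η ∈ D

/-- The set `Δ_α^k` of cycles of length `k` contained in `α`. -/
def cycles (α : SymInv X) (k : ℕ) : Set (SymInv X) := {δ | Contains α δ ∧ IsCycle k δ}

/-- The set `Θ_α^k` of chains of length `k` contained in `α`. -/
def chains (α : SymInv X) (k : ℕ) : Set (SymInv X) := {θ | Contains α θ ∧ IsChain k θ}

/-- The set `Ω_α` of double rays contained in `α`. -/
def doubleRays (α : SymInv X) : Set (SymInv X) := {ω | Contains α ω ∧ IsDoubleRay ω}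

/-- The set `Υ_α` of right rays contained in `α`. -/
def rightRays (α : SymInv X) : Set (SymInv X) := {υ | Contains α υ ∧ IsRightRay υ}

/-- The set `Λ_α` of left rays contained in `α`. -/
def leftRays (α : SymInv X) : Set (SymInv X) := {l | Contains α l ∧ IsLeftRay l}

/-- `k_α = sup {k ≥ 1 : Θ_α^k ≠ ∅}`, which is `0` if there are no chains and `⊤` (for `ℵ₀`) if
the lengths of the chains are unbounded. -/
noncomputable def maxChain (α : SymInv X) : ℕ∞ :=
  ⨆ k ∈ {k : ℕ | 1 ≤ k ∧ (chains α k).Nonempty}, (k : ℕ∞)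

/-- `m_α = max {m ∈ {1, …, k_α} : |Θ_α^m| = ℵ₀}`, and `0` if there is no such `m`.
It is only used when `k_α` is a positive integer, so that the set is bounded. -/
noncomputable def maxInfChain (α : SymInv X) : ℕ :=
  sSup {m : ℕ | 1 ≤ m ∧ (m : ℕ∞) ≤ maxChain α ∧ #(chains α m) = ℵ₀}

end SymInv

/-!
The span of `α` splits into orbits, and the component of `α` on the orbit of `a` is determined, up
to relabelling points, by the set of times `z : ℤ` at which `aα^z` is defined and by the group of
periods of `a`. A conjugator from `α` to `β` amounts to a partial injection that is defined on the
span of `α`, sends steps of `α` to steps of `β`, and sends last points to last points. It induces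
an injection from components to components which preserves periods and may only prolong the time
set into the past: a cycle goes to a cycle of the same length, a right ray to a right ray or a
double ray, a double ray to a double ray, a chain to a chain at least as long or to a left ray, and
a left ray to a left ray. Comparing the numbers of components in the classes that are closed under
these moves gives the necessity of the conditions. For sufficiency the components of `α` are
matched with suitable components of `β`: equal classes are matched by a bijection, and an infinite
class of `β` absorbs in addition everything that may be moved into it.
-/

namespace SymInv

section IntegerPowers

variable {X : Type*} {α β : SymInv X} {a b c : X} {z w : ℤ}

theorem ext_mem (h : ∀ a b, b ∈ α a ↔ b ∈ β a) : α = β :=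
  PEquiv.ext fun a => Option.ext fun b => h a b

theorem mem_mul : c ∈ (α * β) a ↔ ∃ b, b ∈ α a ∧ c ∈ β b :=
  PEquiv.mem_trans α β a c

theorem mem_one : b ∈ (1 : SymInv X) a ↔ a = b :=
  Option.some_inj

theorem notMem_zero : b ∉ (0 : SymInv X) a :=
  Option.not_mem_none b

theorem ne_zero_iff : α ≠ 0 ↔ ∃ a b, b ∈ α a := by
  refine ⟨fun h => ?_, fun ⟨a, b, h⟩ h0 => notMem_zero (h0 ▸ h)⟩
  by_contra! h0
  exact h (ext_mem fun a b => iff_of_false (h0 a b) notMem_zero)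

/-- The inverse semigroup `I(X)` with its natural inversion. It has to be a `DivisionMonoid` for
integer powers to be available: `b ∈ (α ^ z) a` says that `z` steps along `α` lead from `a` to
`b`, where a negative number of steps is taken backwards. -/
instance instDivisionMonoid {X : Type*} : DivisionMonoid (SymInv X) where
  inv := PEquiv.symm
  inv_inv := PEquiv.symm_symm
  mul_inv_rev := PEquiv.symm_trans_rev
  inv_eq_of_mul α β h := by
    have hmem : ∀ a, ∃ b, b ∈ α a ∧ a ∈ β b := fun a => mem_mul.1 (h ▸ mem_one.2 rfl)
    refine ext_mem fun b a => (PEquiv.mem_iff_mem α).trans ⟨fun hb => ?_, fun ha => ?_⟩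
    · obtain ⟨b', hb', ha⟩ := hmem a
      exact Option.mem_unique hb' hb ▸ ha
    · obtain ⟨b', hb', ha'⟩ := hmem a
      exact β.inj ha' ha ▸ hb'

theorem mem_inv : b ∈ α⁻¹ a ↔ a ∈ α b :=
  PEquiv.mem_iff_mem α

theorem mem_zpow_neg : b ∈ (α ^ (-z)) a ↔ a ∈ (α ^ z) b := by
  rw [zpow_neg, mem_inv]

theorem mem_zpow_zero : b ∈ (α ^ (0 : ℤ)) a ↔ a = b := by
  rw [zpow_zero, mem_one]

theorem mem_zpow_one : b ∈ (α ^ (1 : ℤ)) a ↔ b ∈ α a := by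
  rw [zpow_one]

theorem mem_zpow_add_one (hb : b ∈ (α ^ z) a) (hc : c ∈ α b) : c ∈ (α ^ (z + 1)) a := by
  cases z with
  | ofNat n =>
    rw [Int.ofNat_eq_natCast, zpow_natCast] at hb
    rw [Int.ofNat_eq_natCast, ← Nat.cast_succ, zpow_natCast, pow_succ]
    exact mem_mul.2 ⟨b, hb, hc⟩
  | negSucc n =>
    rw [Int.negSucc_eq, mem_zpow_neg, ← Nat.cast_succ, zpow_natCast, pow_succ', mem_mul] at hb
    rw [Int.negSucc_eq, neg_add, neg_add_cancel_right, mem_zpow_neg, zpow_natCast]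
    obtain ⟨c', hc', ha⟩ := hb
    exact Option.mem_unique hc' hc ▸ ha

theorem mem_zpow_sub_one (hb : b ∈ (α ^ z) a) (hc : b ∈ α c) : c ∈ (α ^ (z - 1)) a := by
  rw [← neg_neg z, ← inv_zpow'] at hb
  have h := mem_zpow_add_one hb (mem_inv.2 hc)
  rwa [inv_zpow', neg_add, neg_neg] at h

theorem mem_pow_induction {p : ℕ → X → Prop} (zero : p 0 a)
    (succ : ∀ n b c, p n b → c ∈ α b → p (n + 1) c) {n : ℕ} (hb : b ∈ (α ^ n) a) : p n b := by
  induction n generalizing b with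
  | zero => exact mem_one.1 (pow_zero α ▸ hb) ▸ zero
  | succ n ih =>
    obtain ⟨c, hc, hcb⟩ := mem_mul.1 (pow_succ α n ▸ hb)
    exact succ n c b (ih hc) hcb

theorem mem_zpow_induction {p : ℤ → X → Prop} (zero : p 0 a)
    (succ : ∀ z b c, p z b → c ∈ α b → p (z + 1) c)
    (pred : ∀ z b c, p z b → b ∈ α c → p (z - 1) c) (hb : b ∈ (α ^ z) a) : p z b := by
  obtain ⟨n, rfl | rfl⟩ := z.eq_nat_or_neg
  · rw [zpow_natCast] at hb
    refine mem_pow_induction (p := fun n => p n) zero (fun n b c h hc => ?_) hb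
    simpa using succ n b c h hc
  · rw [← inv_zpow', zpow_natCast] at hb
    refine mem_pow_induction (p := fun n => p (-n)) (by simpa using zero) (fun n b c h hc => ?_) hb
    simpa only [Nat.cast_succ, neg_add'] using pred (-n) b c h (mem_inv.1 hc)

theorem mem_zpow_add (hb : b ∈ (α ^ z) a) (hc : c ∈ (α ^ w) b) : c ∈ (α ^ (z + w)) a := by
  refine mem_zpow_induction (p := fun w c => c ∈ (α ^ (z + w)) a) ((add_zero z).symm ▸ hb)
    (fun w c d h hd => ?_) (fun w c d h hd => ?_) hc
  · exact add_assoc z w 1 ▸ mem_zpow_add_one h hd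
  · exact add_sub_assoc z w 1 ▸ mem_zpow_sub_one h hd

theorem mem_zpow_sub (hb : b ∈ (α ^ z) a) (hc : c ∈ (α ^ w) a) : c ∈ (α ^ (w - z)) b := by
  rw [sub_eq_neg_add]
  exact mem_zpow_add (mem_zpow_neg.2 hb) hc

end IntegerPowers

section Orbits

variable {X : Type*} {α : SymInv X} {a b c : X} {z w : ℤ}

/-- The set of times `z` at which the trajectory of `a` under `α` is defined: an interval of `ℤ`
containing `0`. Its shape tells chains, left rays and right rays apart from each other and from
cycles and double rays. -/
def timeDomain (α : SymInv X) (a : X) : Set ℤ := {z | a ∈ (α ^ z).dom}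

/-- The group of periods of the trajectory of `a` under `α`, by which cycles are told apart from
each other and from double rays. -/
def periods (α : SymInv X) (a : X) : AddSubgroup ℤ where
  carrier := {z | a ∈ (α ^ z) a}
  zero_mem' := mem_zpow_zero.2 rfl
  add_mem' := mem_zpow_add
  neg_mem' := mem_zpow_neg.2

theorem mem_timeDomain : z ∈ timeDomain α a ↔ ∃ b, b ∈ (α ^ z) a := Iff.rfl

theorem mem_periods : z ∈ periods α a ↔ a ∈ (α ^ z) a := Iff.rfl

theorem zero_mem_timeDomain : 0 ∈ timeDomain α a := ⟨a, mem_zpow_zero.2 rfl⟩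

theorem mem_timeDomain_inv : z ∈ timeDomain α⁻¹ a ↔ -z ∈ timeDomain α a := by
  rw [mem_timeDomain, inv_zpow', mem_timeDomain]

theorem mem_timeDomain_of_le (hw : 0 ≤ w) (hwz : w ≤ z) (hz : z ∈ timeDomain α a) :
    w ∈ timeDomain α a := by
  obtain ⟨m, rfl⟩ := Int.eq_ofNat_of_zero_le hw
  obtain ⟨n, rfl⟩ := Int.le.dest hwz
  obtain ⟨c, hc⟩ := hz
  rw [← Nat.cast_add, zpow_natCast, pow_add, mem_mul] at hc
  obtain ⟨b, hb, -⟩ := hc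
  exact ⟨b, (zpow_natCast α m).symm ▸ hb⟩

theorem ordConnected_timeDomain : (timeDomain α a).OrdConnected := by
  refine ⟨fun z hz z' hz' w hw => ?_⟩
  rcases le_total 0 w with h | h
  · exact mem_timeDomain_of_le h hw.2 hz'
  · rw [← neg_neg w, ← mem_timeDomain_inv]
    exact mem_timeDomain_of_le (neg_nonneg.2 h) (neg_le_neg hw.1)
      (mem_timeDomain_inv.2 ((neg_neg z).symm ▸ hz))

theorem mem_timeDomain_iff_of_mem (hb : b ∈ (α ^ z) a) :
    w ∈ timeDomain α b ↔ z + w ∈ timeDomain α a :=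
  ⟨fun ⟨c, hc⟩ => ⟨c, mem_zpow_add hb hc⟩,
    fun ⟨c, hc⟩ => ⟨c, add_sub_cancel_left z w ▸ mem_zpow_sub hb hc⟩⟩

theorem timeDomain_eq_preimage_of_mem (hb : b ∈ (α ^ z) a) :
    timeDomain α b = (z + ·) ⁻¹' timeDomain α a :=
  Set.ext fun _ => mem_timeDomain_iff_of_mem hb

theorem periods_le_of_mem (hb : b ∈ (α ^ z) a) : periods α a ≤ periods α b := fun w hw => by
  have h := mem_zpow_add (mem_zpow_add (mem_zpow_neg.2 hb) hw) hb
  rwa [neg_add_cancel_comm] at h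

theorem periods_eq_of_mem (hb : b ∈ (α ^ z) a) : periods α b = periods α a :=
  (periods_le_of_mem (mem_zpow_neg.2 hb)).antisymm (periods_le_of_mem hb)

theorem add_mem_timeDomain (hw : w ∈ periods α a) (hz : z ∈ timeDomain α a) :
    z + w ∈ timeDomain α a :=
  add_comm w z ▸ (mem_timeDomain_iff_of_mem hw).1 hz

theorem zpow_mem_iff_sub_mem_periods (hb : b ∈ (α ^ z) a) :
    b ∈ (α ^ w) a ↔ w - z ∈ periods α a := by
  rw [← periods_eq_of_mem hb]
  exact ⟨mem_zpow_sub hb, fun h => add_sub_cancel z w ▸ mem_zpow_add hb h⟩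

theorem timeDomain_eq_univ_of_periods_ne_bot (h : periods α a ≠ ⊥) : timeDomain α a = Set.univ := by
  obtain ⟨p, hp, hp0⟩ := (periods α a).bot_or_exists_ne_zero.resolve_left h
  refine Set.eq_univ_of_forall fun z => ?_
  have hmul : ∀ n : ℤ, n * |p| ∈ timeDomain α a := fun n =>
    ⟨a, zsmul_eq_mul |p| n ▸ (periods α a).zsmul_mem (abs_mem_iff.2 hp) n⟩
  have hle : |z| ≤ |z| * |p| := le_mul_of_one_le_right (abs_nonneg z) (Int.one_le_abs hp0)
  refine ordConnected_timeDomain.out (hmul (-|z|)) (hmul |z|) ⟨?_, (le_abs_self z).trans hle⟩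
  rw [neg_mul]
  exact (neg_le_neg hle).trans (neg_abs_le z)

theorem mem_span_iff : a ∈ α.span ↔ 1 ∈ timeDomain α a ∨ -1 ∈ timeDomain α a :=
  or_congr (exists_congr fun _ => mem_zpow_one.symm)
    (exists_congr fun _ => mem_zpow_one.symm.trans mem_zpow_neg.symm)

theorem mem_span_of_mem_timeDomain (hz : z ∈ timeDomain α a) (h0 : z ≠ 0) : a ∈ α.span := by
  rw [mem_span_iff]
  rcases h0.lt_or_gt with h | h
  · exact .inr (ordConnected_timeDomain.out hz zero_mem_timeDomain ⟨by omega, by omega⟩)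
  · exact .inl (ordConnected_timeDomain.out zero_mem_timeDomain hz ⟨by omega, by omega⟩)

/-- Two points are in the same orbit of `α` if one is obtained from the other by steps along `α`,
forwards or backwards. -/
def SameOrbit (α : SymInv X) (a b : X) : Prop := ∃ z : ℤ, b ∈ (α ^ z) a

theorem SameOrbit.refl (a : X) : SameOrbit α a a := ⟨0, mem_zpow_zero.2 rfl⟩

theorem SameOrbit.symm : SameOrbit α a b → SameOrbit α b a
  | ⟨z, h⟩ => ⟨-z, mem_zpow_neg.2 h⟩

theorem SameOrbit.trans : SameOrbit α a b → SameOrbit α b c → SameOrbit α a c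
  | ⟨z, h⟩, ⟨w, h'⟩ => ⟨z + w, mem_zpow_add h h'⟩

theorem sameOrbit_of_mem (h : b ∈ α a) : SameOrbit α a b := ⟨1, mem_zpow_one.2 h⟩

theorem SameOrbit.periods_eq : SameOrbit α a b → periods α b = periods α a
  | ⟨_, h⟩ => periods_eq_of_mem h

theorem SameOrbit.bddAbove (h : SameOrbit α a b) (ha : BddAbove (timeDomain α a)) :
    BddAbove (timeDomain α b) := by
  obtain ⟨z, hz⟩ := h
  obtain ⟨m, hm⟩ := ha
  exact ⟨m - z, fun w hw => le_sub_iff_add_le'.2 (hm ((mem_timeDomain_iff_of_mem hz).1 hw))⟩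

theorem SameOrbit.bddBelow (h : SameOrbit α a b) (ha : BddBelow (timeDomain α a)) :
    BddBelow (timeDomain α b) := by
  obtain ⟨z, hz⟩ := h
  obtain ⟨m, hm⟩ := ha
  exact ⟨m - z, fun w hw => sub_le_iff_le_add'.2 (hm ((mem_timeDomain_iff_of_mem hz).1 hw))⟩

theorem SameOrbit.mem_span (h : SameOrbit α a b) (ha : a ∈ α.span) : b ∈ α.span := by
  obtain ⟨z, hz⟩ := h
  rcases eq_or_ne z 0 with rfl | h0
  · exact mem_zpow_zero.1 hz ▸ ha
  · exact mem_span_of_mem_timeDomain ⟨a, mem_zpow_neg.2 hz⟩ (neg_ne_zero.2 h0)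

open scoped Classical in
/-- The restriction of `α` to the orbit of `a`. The terms of the cycle-chain-ray decomposition of
`α` are the components of the points of its span. -/
noncomputable def component (α : SymInv X) (a : X) : SymInv X :=
  PEquiv.ofSet {c | SameOrbit α a c} * α

theorem mem_component : c ∈ component α a b ↔ SameOrbit α a b ∧ c ∈ α b := by
  simp only [component, mem_mul, PEquiv.mem_ofSet_iff, Set.mem_ofPred_eq]
  exact ⟨fun ⟨_, ⟨rfl, h⟩, h'⟩ => ⟨h, h'⟩, fun ⟨h, h'⟩ => ⟨b, ⟨rfl, h⟩, h'⟩⟩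

theorem SameOrbit.component_eq (h : SameOrbit α a b) : component α a = component α b :=
  ext_mem fun c d => by
    simp only [mem_component]
    exact and_congr_left fun _ => ⟨h.symm.trans, h.trans⟩

theorem mem_span_component : b ∈ (component α a).span ↔ SameOrbit α a b ∧ b ∈ α.span := by
  constructor
  · rintro (⟨c, hc⟩ | ⟨c, hc⟩) <;> obtain ⟨h, h'⟩ := mem_component.1 hc
    · exact ⟨h, .inl ⟨c, h'⟩⟩
    · exact ⟨h.trans (sameOrbit_of_mem h'), .inr ⟨c, h'⟩⟩
  · rintro ⟨h, ⟨c, hc⟩ | ⟨c, hc⟩⟩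
    · exact .inl ⟨c, mem_component.2 ⟨h, hc⟩⟩
    · exact .inr ⟨c, mem_component.2 ⟨h.trans (sameOrbit_of_mem hc).symm, hc⟩⟩

theorem sameOrbit_of_component_eq (ha : a ∈ α.span) (h : component α a = component α b) :
    SameOrbit α b a :=
  (mem_span_component.1 (h ▸ mem_span_component.2 ⟨.refl a, ha⟩)).1

theorem disjoint_image_component {s t : Set X} (hs : s ⊆ α.span)
    (h : ∀ a ∈ s, ∀ b ∈ t, ¬ SameOrbit α b a) : Disjoint (component α '' s) (component α '' t) := by
  rw [Set.disjoint_left]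
  rintro _ ⟨a, ha, rfl⟩ ⟨b, hb, hab⟩
  exact h a ha b hb (sameOrbit_of_component_eq (hs ha) hab.symm)

end Orbits

section OrbitMaps

variable {X : Type*} {η : SymInv X} {b : X} {k : ℕ} {z w : ℤ} {I : Set ℤ}
  {P : AddSubgroup ℤ} {x : ℤ → X}

/-- `η` consists of a single orbit, which is parametrized by `x` on the interval `I` in such a way
that `η` becomes `z ↦ z + 1` and two times give the same point if and only if they differ by an
element of `P`. All basic transformations are of this form. -/
structure IsOrbitMap (I : Set ℤ) (P : AddSubgroup ℤ) (x : ℤ → X) (η : SymInv X) : Prop where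
  ordConnected : I.OrdConnected
  add_mem : ∀ z ∈ I, ∀ w ∈ P, z + w ∈ I
  apply_eq_iff : ∀ z ∈ I, ∀ w ∈ I, x z = x w ↔ w - z ∈ P
  mem_iff : ∀ a b, b ∈ η a ↔ ∃ z ∈ I, z + 1 ∈ I ∧ x z = a ∧ x (z + 1) = b

namespace IsOrbitMap

theorem comp_add (h : IsOrbitMap I P x η) (w : ℤ) :
    IsOrbitMap ((w + ·) ⁻¹' I) P (fun z => x (w + z)) η where
  ordConnected := ⟨fun z hz z' hz' u hu =>
    h.ordConnected.out hz hz' ⟨add_le_add_right hu.1 w, add_le_add_right hu.2 w⟩⟩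
  add_mem z hz p hp := by
    rw [Set.mem_preimage, ← add_assoc]
    exact h.add_mem _ hz p hp
  apply_eq_iff z hz z' hz' := by
    rw [h.apply_eq_iff _ hz _ hz', add_sub_add_left_eq_sub]
  mem_iff a b := by
    simp only [h.mem_iff, Set.mem_preimage, ← add_assoc]
    exact (Equiv.addLeft w).surjective.exists
      (p := fun z => z ∈ I ∧ z + 1 ∈ I ∧ x z = a ∧ x (z + 1) = b)

theorem apply_mem_pow (h : IsOrbitMap I P x η) (hz : z ∈ I) {n : ℕ} (hn : z + n ∈ I) :
    x (z + n) ∈ (η ^ (n : ℤ)) (x z) := by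
  induction n with
  | zero => exact mem_zpow_zero.2 (by simp)
  | succ n ih =>
    rw [Nat.cast_succ, ← add_assoc] at hn ⊢
    have hn' : z + n ∈ I := h.ordConnected.out hz hn ⟨by omega, by omega⟩
    exact mem_zpow_add_one (ih hn') ((h.mem_iff _ _).2 ⟨_, hn', hn, rfl, rfl⟩)

theorem apply_mem_zpow (h : IsOrbitMap I P x η) (hz : z ∈ I) (hw : z + w ∈ I) :
    x (z + w) ∈ (η ^ w) (x z) := by
  obtain ⟨n, rfl | rfl⟩ := w.eq_nat_or_neg
  · exact h.apply_mem_pow hz hw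
  · have h' := h.apply_mem_pow hw (n := n) (by rwa [neg_add_cancel_right])
    rw [neg_add_cancel_right] at h'
    exact mem_zpow_neg.2 h'

theorem mem_zpow_iff (h : IsOrbitMap I P x η) (hz : z ∈ I) :
    b ∈ (η ^ w) (x z) ↔ z + w ∈ I ∧ x (z + w) = b := by
  refine ⟨fun hb => ?_, fun ⟨hw, hb⟩ => hb ▸ h.apply_mem_zpow hz hw⟩
  have shift : ∀ {u v i : ℤ}, u ∈ I → v ∈ I → v + i ∈ I → x v = x u →
      u + i ∈ I ∧ x (u + i) = x (v + i) := fun {u v i} hu hv hi huv => by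
    have hp := (h.apply_eq_iff v hv u hu).1 huv
    have hui : u + i ∈ I := by
      have := h.add_mem _ hi _ hp
      rwa [add_right_comm, add_sub_cancel] at this
    refine ⟨hui, ((h.apply_eq_iff _ hi _ hui).2 ?_).symm⟩
    rwa [add_sub_add_right_eq_sub]
  refine mem_zpow_induction (p := fun w b => z + w ∈ I ∧ x (z + w) = b) (by simpa using hz)
    (fun w b c ⟨hw, hb⟩ hc => ?_) (fun w b c ⟨hw, hb⟩ hc => ?_) hb
  · obtain ⟨v, hv, hv', rfl, rfl⟩ := (h.mem_iff _ _).1 hc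
    exact add_assoc z w 1 ▸ shift hw hv hv' hb.symm
  · obtain ⟨v, hv, hv', rfl, rfl⟩ := (h.mem_iff _ _).1 hc
    have := shift (i := -1) hw hv' (by simpa using hv) hb.symm
    rwa [add_neg_cancel_right, add_assoc] at this

theorem timeDomain_eq (h : IsOrbitMap I P x η) (hz : z ∈ I) :
    timeDomain η (x z) = (z + ·) ⁻¹' I :=
  Set.ext fun w => (exists_congr fun _ => h.mem_zpow_iff hz).trans (by simp)

theorem periods_eq (h : IsOrbitMap I P x η) (hz : z ∈ I) : periods η (x z) = P := by
  ext w
  rw [mem_periods, h.mem_zpow_iff hz]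
  refine ⟨fun ⟨hw, hx⟩ => ?_, fun hw => ⟨h.add_mem z hz w hw, ?_⟩⟩
  · simpa using (h.apply_eq_iff z hz _ hw).1 hx.symm
  · exact ((h.apply_eq_iff z hz _ (h.add_mem z hz w hw)).2 (by simpa using hw)).symm

theorem sameOrbit (h : IsOrbitMap I P x η) (hz : z ∈ I) (hw : w ∈ I) :
    SameOrbit η (x z) (x w) :=
  ⟨w - z, (h.mem_zpow_iff hz).2 (by simpa using hw)⟩

end IsOrbitMap

theorem exists_isOrbitMap_component (α : SymInv X) (a : X) :
    ∃ x, IsOrbitMap (timeDomain α a) (periods α a) x (component α a) := by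
  have hx : ∀ z : ℤ, ∃ b, z ∈ timeDomain α a → b ∈ (α ^ z) a := fun z => by
    by_cases hz : z ∈ timeDomain α a
    · exact hz.imp fun b hb _ => hb
    · exact ⟨a, fun h => absurd h hz⟩
  choose x hx using hx
  refine ⟨x, ordConnected_timeDomain, fun z hz w hw => add_mem_timeDomain hw hz,
    fun z hz w hw => ?_, fun b c => ?_⟩
  · rw [← zpow_mem_iff_sub_mem_periods (hx z hz)]
    exact ⟨fun h => h ▸ hx w hw, fun h => Option.mem_unique h (hx w hw)⟩
  · rw [mem_component]
    constructor
    · rintro ⟨⟨z, hb⟩, hc⟩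
      have hc := mem_zpow_add_one hb hc
      exact ⟨z, ⟨b, hb⟩, ⟨c, hc⟩, Option.mem_unique (hx z ⟨b, hb⟩) hb,
        Option.mem_unique (hx _ ⟨c, hc⟩) hc⟩
    · rintro ⟨z, hz, hz', rfl, rfl⟩
      have h := mem_zpow_sub (hx z hz) (hx _ hz')
      rw [add_sub_cancel_left, mem_zpow_one] at h
      exact ⟨⟨z, hx z hz⟩, h⟩

theorem isOrbitMap_bot_iff (hI : I.OrdConnected) :
    IsOrbitMap I ⊥ x η ↔ Set.InjOn x I ∧
      ∀ a b, b ∈ η a ↔ ∃ z ∈ I, z + 1 ∈ I ∧ x z = a ∧ x (z + 1) = b := by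
  refine ⟨fun h => ⟨fun z hz w hw hzw => ?_, h.mem_iff⟩, fun ⟨hinj, hmem⟩ => ⟨hI, ?_, ?_, hmem⟩⟩
  · exact (sub_eq_zero.1 ((h.apply_eq_iff z hz w hw).1 hzw)).symm
  · rintro z hz _ rfl
    rwa [add_zero]
  · intro z hz w hw
    rw [hinj.eq_iff hz hw, AddSubgroup.mem_bot, sub_eq_zero, eq_comm]

theorem isDoubleRay_iff : IsDoubleRay η ↔ ∃ x, IsOrbitMap Set.univ ⊥ x η := by
  simp only [isOrbitMap_bot_iff Set.ordConnected_univ, Set.injOn_univ, Set.mem_univ, true_and]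
  rfl

theorem exists_isOrbitMap_bot_iff (hI : I.OrdConnected) {e : ℕ → ℤ} (he : e.Injective)
    (hIe : I ⊆ Set.range e) :
    (∃ x, IsOrbitMap I ⊥ x η) ↔ ∃ x : ℕ → X, Set.InjOn x (e ⁻¹' I) ∧
      ∀ a b, b ∈ η a ↔ ∃ m n, e m ∈ I ∧ e n ∈ I ∧ e n = e m + 1 ∧ x m = a ∧ x n = b := by
  simp only [isOrbitMap_bot_iff hI]
  constructor
  · rintro ⟨x, hinj, hmem⟩
    refine ⟨x ∘ e, fun m hm n hn h => he (hinj hm hn h), fun a b => (hmem a b).trans ⟨?_, ?_⟩⟩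
    · rintro ⟨z, hz, hz', rfl, rfl⟩
      obtain ⟨m, rfl⟩ := hIe hz
      obtain ⟨n, hn⟩ := hIe hz'
      exact ⟨m, n, hz, hn ▸ hz', hn, rfl, congrArg x hn⟩
    · rintro ⟨m, n, hm, hn, hmn, rfl, rfl⟩
      exact ⟨e m, hm, hmn ▸ hn, rfl, congrArg x hmn.symm⟩
  · rintro ⟨x, hinj, hmem⟩
    have hinv := Function.leftInverse_invFun he
    refine ⟨x ∘ Function.invFun e, fun z hz w hw h => ?_, fun a b => (hmem a b).trans ⟨?_, ?_⟩⟩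
    · obtain ⟨m, rfl⟩ := hIe hz
      obtain ⟨n, rfl⟩ := hIe hw
      rw [Function.comp_apply, Function.comp_apply, hinv, hinv] at h
      rw [hinj hz hw h]
    · rintro ⟨m, n, hm, hn, hmn, rfl, rfl⟩
      exact ⟨e m, hm, hmn ▸ hn, congrArg x (hinv m), hmn ▸ congrArg x (hinv n)⟩
    · rintro ⟨z, hz, hz', rfl, rfl⟩
      obtain ⟨m, rfl⟩ := hIe hz
      obtain ⟨n, hn⟩ := hIe hz'
      rw [← hn] at hz' ⊢
      exact ⟨m, n, hz, hz', hn, congrArg x (hinv m).symm, congrArg x (hinv n).symm⟩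

theorem isRightRay_iff : IsRightRay η ↔ ∃ x, IsOrbitMap (Set.Ici 0) ⊥ x η := by
  rw [exists_isOrbitMap_bot_iff Set.ordConnected_Ici Nat.cast_injective
    fun z hz => ⟨z.toNat, Int.toNat_of_nonneg hz⟩]
  refine exists_congr fun x => and_congr ?_ (forall₂_congr fun a b => iff_congr Iff.rfl ?_)
  · have hpre : Nat.cast ⁻¹' Set.Ici (0 : ℤ) = Set.univ := Set.eq_univ_of_forall fun n => by simp
    rw [hpre, Set.injOn_univ]
  · refine ⟨fun ⟨i, ha, hb⟩ => ⟨i, i + 1, Set.mem_Ici.2 (by omega), Set.mem_Ici.2 (by omega),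
      by simp, ha, hb⟩, ?_⟩
    rintro ⟨m, n, -, -, h, ha, hb⟩
    obtain rfl : n = m + 1 := by omega
    exact ⟨m, ha, hb⟩

theorem isLeftRay_iff : IsLeftRay η ↔ ∃ x, IsOrbitMap (Set.Iic 0) ⊥ x η := by
  rw [exists_isOrbitMap_bot_iff Set.ordConnected_Iic (neg_injective.comp Nat.cast_injective)
    fun z hz => ⟨(-z).toNat, by
      rw [Function.comp_apply, Int.toNat_of_nonneg (neg_nonneg.2 hz), neg_neg]⟩]
  refine exists_congr fun x => and_congr ?_ (forall₂_congr fun a b => iff_congr Iff.rfl ?_)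
  · have hpre : (Neg.neg ∘ Nat.cast) ⁻¹' Set.Iic (0 : ℤ) = Set.univ :=
      Set.eq_univ_of_forall fun n => by simp
    rw [hpre, Set.injOn_univ]
  · refine ⟨fun ⟨i, ha, hb⟩ => ⟨i + 1, i, by simp, by simp, by simp, ha, hb⟩, ?_⟩
    rintro ⟨m, n, -, -, h, ha, hb⟩
    obtain rfl : m = n + 1 := by simp only [Function.comp_apply] at h; omega
    exact ⟨n, ha, hb⟩

theorem isChain_iff : IsChain k η ↔ 1 ≤ k ∧ ∃ x, IsOrbitMap (Set.Icc 0 k) ⊥ x η := by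
  rw [exists_isOrbitMap_bot_iff Set.ordConnected_Icc Nat.cast_injective
    fun z hz => ⟨z.toNat, Int.toNat_of_nonneg hz.1⟩]
  refine and_congr_right fun _ => exists_congr fun x =>
    and_congr ?_ (forall₂_congr fun a b => iff_congr Iff.rfl ?_)
  · have hpre : Nat.cast ⁻¹' Set.Icc (0 : ℤ) k = Set.Iic k := Set.ext fun n => by simp
    rw [hpre]
  · refine ⟨fun ⟨i, hi, ha, hb⟩ => ⟨i, i + 1, ⟨by omega, by omega⟩, ⟨by omega, by omega⟩,
      by simp, ha, hb⟩, ?_⟩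
    rintro ⟨m, n, -, hn, h, ha, hb⟩
    obtain rfl : n = m + 1 := by omega
    exact ⟨m, Nat.cast_le.1 hn.2, ha, hb⟩

theorem isCycle_iff :
    IsCycle k η ↔ 1 ≤ k ∧ ∃ x, IsOrbitMap Set.univ (AddSubgroup.zmultiples (k : ℤ)) x η := by
  refine and_congr_right fun hk => ?_
  have hmod : ∀ z : ℤ, ((z % k).toNat : ℤ) = z % k := fun z =>
    Int.toNat_of_nonneg (Int.emod_nonneg z (by omega))
  have hlt : ∀ z : ℤ, (z % k).toNat < k := fun z => by
    have := Int.emod_lt_of_pos z (b := k) (by omega)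
    omega
  have hsucc : ∀ z : ℤ, ((z % k).toNat + 1) % k = ((z + 1) % k).toNat := fun z => by
    rw [← Nat.cast_inj (R := ℤ), hmod]
    push_cast
    rw [hmod, Int.emod_add_emod]
  constructor
  · rintro ⟨x, hinj, hmem⟩
    refine ⟨fun z => x (z % k).toNat, Set.ordConnected_univ, fun _ _ _ _ => trivial,
      fun z _ w _ => ?_, fun a b => (hmem a b).trans ⟨?_, ?_⟩⟩
    · rw [hinj.eq_iff (hlt z) (hlt w), ← Nat.cast_inj (R := ℤ), hmod, hmod,
        Int.mem_zmultiples_iff]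
      exact Int.modEq_iff_dvd
    · rintro ⟨i, hi, rfl, rfl⟩
      have hi' : ((i : ℤ) % k).toNat = i := by
        rw [← Nat.cast_inj (R := ℤ), hmod, Int.emod_eq_of_lt (by omega) (by omega)]
      exact ⟨i, trivial, trivial, by rw [hi'], by rw [← hsucc, hi']⟩
    · rintro ⟨z, -, -, rfl, rfl⟩
      exact ⟨_, hlt z, rfl, by rw [hsucc]⟩
  · rintro ⟨x, hx⟩
    have hx_eq : ∀ z w : ℤ, x z = x w ↔ z ≡ w [ZMOD k] := fun z w => by
      rw [hx.apply_eq_iff z trivial w trivial, Int.mem_zmultiples_iff, Int.modEq_iff_dvd]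
    refine ⟨fun n => x n, fun m hm n hn h => ?_, fun a b => (hx.mem_iff a b).trans ⟨?_, ?_⟩⟩
    · exact ((Int.natCast_modEq_iff).1 ((hx_eq m n).1 h)).eq_of_lt_of_lt hm hn
    · rintro ⟨z, -, -, rfl, rfl⟩
      refine ⟨_, hlt z, (hx_eq _ _).2 ?_, (hx_eq _ _).2 ?_⟩
      · exact hmod z ▸ Int.mod_modEq z k
      · exact hsucc z ▸ hmod (z + 1) ▸ Int.mod_modEq (z + 1) k
    · rintro ⟨i, -, rfl, rfl⟩
      exact ⟨i, trivial, trivial, rfl, (hx_eq _ _).2 (by push_cast; exact (Int.mod_modEq _ _).symm)⟩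

end OrbitMaps

section Decomposition

variable {X : Type*} {α η : SymInv X} {a b : X} {k : ℕ} {z : ℤ} {I : Set ℤ} {P : AddSubgroup ℤ}
  {x : ℤ → X}

theorem exists_eq_Ici_of_ordConnected (hI : I.OrdConnected) (hne : I.Nonempty) (hb : BddBelow I)
    (ha : ¬ BddAbove I) : ∃ m, I = Set.Ici m := by
  refine ⟨sInf I, Set.Subset.antisymm (fun z hz => csInf_le hb hz) fun z hz => ?_⟩
  obtain ⟨w, hw, hzw⟩ := not_bddAbove_iff.1 ha z
  exact hI.out (Int.csInf_mem hne hb) hw ⟨hz, hzw.le⟩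

theorem exists_eq_Iic_of_ordConnected (hI : I.OrdConnected) (hne : I.Nonempty)
    (hb : ¬ BddBelow I) (ha : BddAbove I) : ∃ m, I = Set.Iic m := by
  refine ⟨sSup I, Set.Subset.antisymm (fun z hz => le_csSup ha hz) fun z hz => ?_⟩
  obtain ⟨w, hw, hwz⟩ := not_bddBelow_iff.1 hb z
  exact hI.out hw (Int.csSup_mem hne ha) ⟨hwz.le, hz⟩

theorem exists_eq_Icc_of_ordConnected (hI : I.OrdConnected) (hne : I.Nonempty) (hb : BddBelow I)
    (ha : BddAbove I) : ∃ m n, I = Set.Icc m n :=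
  ⟨sInf I, sSup I, Set.Subset.antisymm (fun _ hz => ⟨csInf_le hb hz, le_csSup ha hz⟩) fun _ hz =>
    hI.out (Int.csInf_mem hne hb) (Int.csSup_mem hne ha) hz⟩

theorem eq_univ_of_ordConnected {M : Type*} [LinearOrder M] {I : Set M} (hI : I.OrdConnected)
    (hb : ¬ BddBelow I) (ha : ¬ BddAbove I) : I = Set.univ := by
  refine Set.eq_univ_of_forall fun z => ?_
  obtain ⟨w, hw, hwz⟩ := not_bddBelow_iff.1 hb z
  obtain ⟨w', hw', hzw'⟩ := not_bddAbove_iff.1 ha z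
  exact hI.out hw hw' ⟨hwz.le, hzw'.le⟩

theorem exists_eq_zmultiples_natCast (P : AddSubgroup ℤ) :
    ∃ k : ℕ, P = AddSubgroup.zmultiples (k : ℤ) := by
  obtain ⟨p, rfl⟩ := Int.subgroup_cyclic P
  exact ⟨p.natAbs, by rw [← AddSubgroup.zmultiples_eq_closure, Int.zmultiples_natAbs]⟩

theorem isBasic_component (ha : a ∈ α.span) : IsBasic (component α a) := by
  obtain ⟨x, hx⟩ := exists_isOrbitMap_component α a
  by_cases hP : periods α a = ⊥
  · rw [hP] at hx
    have hne : (timeDomain α a).Nonempty := ⟨0, zero_mem_timeDomain⟩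
    by_cases hA : BddAbove (timeDomain α a) <;> by_cases hB : BddBelow (timeDomain α a)
    · obtain ⟨m, n, hmn⟩ := exists_eq_Icc_of_ordConnected ordConnected_timeDomain hne hB hA
      have hlt : m < n := by
        have h0 := zero_mem_timeDomain (α := α) (a := a)
        have h1 := mem_span_iff.1 ha
        simp only [hmn, Set.mem_Icc] at h0 h1
        omega
      have h := hmn ▸ hx.comp_add m
      rw [Set.preimage_const_add_Icc, sub_self, ← Int.toNat_of_nonneg (sub_nonneg.2 hlt.le)] at h
      exact .inr (.inl ⟨_, isChain_iff.2 ⟨by omega, _, h⟩⟩)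
    · obtain ⟨m, hm⟩ := exists_eq_Iic_of_ordConnected ordConnected_timeDomain hne hB hA
      have h := hm ▸ hx.comp_add m
      rw [Set.preimage_const_add_Iic, sub_self] at h
      exact .inr (.inr (.inr (.inr (isLeftRay_iff.2 ⟨_, h⟩))))
    · obtain ⟨m, hm⟩ := exists_eq_Ici_of_ordConnected ordConnected_timeDomain hne hB hA
      have h := hm ▸ hx.comp_add m
      rw [Set.preimage_const_add_Ici, sub_self] at h
      exact .inr (.inr (.inr (.inl (isRightRay_iff.2 ⟨_, h⟩))))
    · rw [eq_univ_of_ordConnected ordConnected_timeDomain hB hA] at hx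
      exact .inr (.inr (.inl (isDoubleRay_iff.2 ⟨_, hx⟩)))
  · rw [timeDomain_eq_univ_of_periods_ne_bot hP] at hx
    obtain ⟨k, hk⟩ := exists_eq_zmultiples_natCast (periods α a)
    have hk0 : k ≠ 0 := fun h =>
      hP (by rw [hk, h, Nat.cast_zero, AddSubgroup.zmultiples_zero_eq_bot])
    exact .inl ⟨k, isCycle_iff.2 ⟨by omega, x, hk ▸ hx⟩⟩

theorem isDecomposition_components (α : SymInv X) :
    IsDecomposition α (component α '' α.span) := by
  refine ⟨?_, ?_, fun a b => ?_⟩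
  · rintro _ ⟨a, ha, rfl⟩
    exact isBasic_component ha
  · rintro _ ⟨a, -, rfl⟩ _ ⟨b, -, rfl⟩ hne
    refine Set.eq_empty_of_forall_notMem fun c ⟨hac, hbc⟩ => hne ?_
    exact ((mem_span_component.1 hac).1.trans (mem_span_component.1 hbc).1.symm).component_eq
  · constructor
    · exact fun h => ⟨_, ⟨a, .inl ⟨b, h⟩, rfl⟩, mem_component.2 ⟨.refl a, h⟩⟩
    · rintro ⟨_, ⟨c, -, rfl⟩, h⟩
      exact (mem_component.1 h).2

theorem contains_component (ha : a ∈ α.span) : Contains α (component α a) :=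
  ⟨_, isDecomposition_components α, a, ha, rfl⟩

theorem IsBasic.span_nonempty (h : IsBasic η) : η.span.Nonempty := by
  rcases h with ⟨k, hk, x, -, h⟩ | ⟨k, hk, x, -, h⟩ | ⟨x, -, h⟩ | ⟨x, -, h⟩ | ⟨x, -, h⟩
  · exact ⟨x 0, .inl ⟨_, (h _ _).2 ⟨0, hk, rfl, rfl⟩⟩⟩
  · exact ⟨x 0, .inl ⟨_, (h _ _).2 ⟨0, hk, rfl, rfl⟩⟩⟩
  · exact ⟨x 0, .inl ⟨_, (h _ _).2 ⟨0, rfl, rfl⟩⟩⟩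
  · exact ⟨x 0, .inl ⟨_, (h _ _).2 ⟨0, rfl, rfl⟩⟩⟩
  · exact ⟨x 0, .inr ⟨_, (h _ _).2 ⟨0, rfl, rfl⟩⟩⟩

theorem Contains.span_nonempty : Contains α η → η.span.Nonempty
  | ⟨_, hD, hη⟩ => (hD.1 η hη).span_nonempty

theorem Contains.mem_of_mem : Contains α η → b ∈ η a → b ∈ α a
  | ⟨_, hD, hη⟩, h => (hD.2.2 a b).2 ⟨η, hη, h⟩

theorem Contains.mem_of_mem_span (h : Contains α η) (hab : a ∈ η.span ∨ b ∈ η.span)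
    (hb : b ∈ α a) : b ∈ η a := by
  obtain ⟨D, hD, hη⟩ := h
  obtain ⟨θ, hθ, hbθ⟩ := (hD.2.2 a b).1 hb
  suffices η = θ from this ▸ hbθ
  by_contra hne
  have hdisj : Disjoint η.span θ.span := Set.disjoint_iff_inter_eq_empty.2 (hD.2.1 hη hθ hne)
  rcases hab with ha | hb
  · exact hdisj.notMem_of_mem_left ha (.inl ⟨b, hbθ⟩)
  · exact hdisj.notMem_of_mem_left hb (.inr ⟨a, hbθ⟩)

theorem Contains.mem_zpow_iff (h : Contains α η) (ha : a ∈ η.span) :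
    b ∈ (α ^ z) a ↔ b ∈ (η ^ z) a := by
  refine ⟨mem_zpow_induction (p := fun z b => b ∈ (η ^ z) a) (mem_zpow_zero.2 rfl) ?_ ?_,
    mem_zpow_induction (p := fun z b => b ∈ (α ^ z) a) (mem_zpow_zero.2 rfl) ?_ ?_⟩
  · exact fun z b c hb hc => mem_zpow_add_one hb <|
      h.mem_of_mem_span (.inl (SameOrbit.mem_span ⟨z, hb⟩ ha)) hc
  · exact fun z b c hb hc => mem_zpow_sub_one hb <|
      h.mem_of_mem_span (.inr (SameOrbit.mem_span ⟨z, hb⟩ ha)) hc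
  · exact fun z b c hb hc => mem_zpow_add_one hb (h.mem_of_mem hc)
  · exact fun z b c hb hc => mem_zpow_sub_one hb (h.mem_of_mem hc)

theorem Contains.timeDomain_eq (h : Contains α η) (ha : a ∈ η.span) :
    timeDomain α a = timeDomain η a :=
  Set.ext fun _ => exists_congr fun _ => h.mem_zpow_iff ha

theorem Contains.periods_eq (h : Contains α η) (ha : a ∈ η.span) : periods α a = periods η a :=
  SetLike.ext fun _ => h.mem_zpow_iff ha

theorem Contains.component_eq (h : Contains α η) (ha : a ∈ η.span)
    (hη : ∀ b ∈ η.span, SameOrbit η a b) : component α a = η := by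
  refine ext_mem fun b c => mem_component.trans ⟨fun ⟨⟨z, hb⟩, hc⟩ => ?_, fun hc => ⟨?_, ?_⟩⟩
  · exact h.mem_of_mem_span (.inl (SameOrbit.mem_span ⟨z, (h.mem_zpow_iff ha).1 hb⟩ ha)) hc
  · exact (hη b (.inl ⟨c, hc⟩)).imp fun z hz => (h.mem_zpow_iff ha).2 hz
  · exact h.mem_of_mem hc

theorem IsOrbitMap.exists_apply_eq (h : IsOrbitMap I P x η) (ha : a ∈ η.span) :
    ∃ z ∈ I, x z = a := by
  rcases ha with ⟨b, hb⟩ | ⟨b, hb⟩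
  · obtain ⟨z, hz, -, hza, -⟩ := (h.mem_iff _ _).1 hb
    exact ⟨z, hz, hza⟩
  · obtain ⟨z, -, hz, -, hza⟩ := (h.mem_iff _ _).1 hb
    exact ⟨z + 1, hz, hza⟩

theorem setOf_contains_isOrbitMap (α : SymInv X) (I : Set ℤ) (P : AddSubgroup ℤ) :
    {η | Contains α η ∧ ∃ x, IsOrbitMap I P x η} = component α ''
      {a ∈ α.span | (∃ z, timeDomain α a = (z + ·) ⁻¹' I) ∧ periods α a = P} := by
  ext η
  constructor
  · rintro ⟨hη, x, hx⟩
    obtain ⟨a, ha⟩ := hη.span_nonempty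
    obtain ⟨z, hz, rfl⟩ := hx.exists_apply_eq ha
    have hcomp : component α (x z) = η := hη.component_eq ha fun b hb => by
      obtain ⟨w, hw, rfl⟩ := hx.exists_apply_eq hb
      exact hx.sameOrbit hz hw
    refine ⟨x z, ⟨(mem_span_component.1 (hcomp ▸ ha)).2, ⟨z, ?_⟩, ?_⟩, hcomp⟩
    · rw [hη.timeDomain_eq ha, hx.timeDomain_eq hz]
    · rw [hη.periods_eq ha, hx.periods_eq hz]
  · rintro ⟨a, ⟨ha, ⟨z, hz⟩, rfl⟩, rfl⟩
    obtain ⟨x, hx⟩ := exists_isOrbitMap_component α a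
    have h := hx.comp_add (-z)
    rw [hz, Set.preimage_preimage] at h
    simp only [add_neg_cancel_left, Set.preimage_id'] at h
    exact ⟨contains_component ha, _, h⟩

theorem cycles_eq (hk : 1 ≤ k) : α.cycles k =
    component α '' {a ∈ α.span | periods α a = AddSubgroup.zmultiples (k : ℤ)} := by
  simp only [cycles, isCycle_iff, hk, true_and, setOf_contains_isOrbitMap, Set.preimage_univ,
    exists_const]
  congr! 4 with a
  refine and_iff_right_of_imp fun h => timeDomain_eq_univ_of_periods_ne_bot ?_
  rw [h, Ne, AddSubgroup.zmultiples_eq_bot]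
  omega

theorem doubleRays_eq : α.doubleRays =
    component α '' {a ∈ α.span | timeDomain α a = Set.univ ∧ periods α a = ⊥} := by
  simp only [doubleRays, isDoubleRay_iff, setOf_contains_isOrbitMap, Set.preimage_univ,
    exists_const]

theorem periods_eq_bot_of_ne_univ (h : timeDomain α a ≠ Set.univ) : periods α a = ⊥ :=
  not_not.1 (mt timeDomain_eq_univ_of_periods_ne_bot h)

theorem periods_eq_bot_of_bddAbove (h : BddAbove (timeDomain α a)) : periods α a = ⊥ :=
  periods_eq_bot_of_ne_univ fun h' => not_bddAbove_univ (h' ▸ h)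

theorem periods_eq_bot_of_bddBelow (h : BddBelow (timeDomain α a)) : periods α a = ⊥ :=
  periods_eq_bot_of_ne_univ fun h' => not_bddBelow_univ (h' ▸ h)

theorem rightRays_eq : α.rightRays = component α ''
    {a ∈ α.span | BddBelow (timeDomain α a) ∧ ¬ BddAbove (timeDomain α a)} := by
  simp only [rightRays, isRightRay_iff, setOf_contains_isOrbitMap, Set.preimage_const_add_Ici]
  congr! 4 with a
  constructor
  · rintro ⟨⟨z, hz⟩, -⟩
    rw [hz]
    exact ⟨bddBelow_Ici, not_bddAbove_Ici _⟩
  · rintro ⟨hB, hA⟩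
    obtain ⟨m, hm⟩ :=
      exists_eq_Ici_of_ordConnected ordConnected_timeDomain ⟨0, zero_mem_timeDomain⟩ hB hA
    exact ⟨⟨-m, by simpa using hm⟩, periods_eq_bot_of_bddBelow hB⟩

theorem leftRays_eq : α.leftRays = component α ''
    {a ∈ α.span | BddAbove (timeDomain α a) ∧ ¬ BddBelow (timeDomain α a)} := by
  simp only [leftRays, isLeftRay_iff, setOf_contains_isOrbitMap, Set.preimage_const_add_Iic]
  congr! 4 with a
  constructor
  · rintro ⟨⟨z, hz⟩, -⟩
    rw [hz]
    exact ⟨bddAbove_Iic, not_bddBelow_Iic _⟩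
  · rintro ⟨hA, hB⟩
    obtain ⟨m, hm⟩ :=
      exists_eq_Iic_of_ordConnected ordConnected_timeDomain ⟨0, zero_mem_timeDomain⟩ hB hA
    exact ⟨⟨-m, by simpa using hm⟩, periods_eq_bot_of_bddAbove hA⟩

theorem chains_eq (hk : 1 ≤ k) : α.chains k =
    component α '' {a ∈ α.span | ∃ z : ℤ, timeDomain α a = Set.Icc z (z + k)} := by
  simp only [chains, isChain_iff, hk, true_and, setOf_contains_isOrbitMap,
    Set.preimage_const_add_Icc]
  congr! 4 with a
  constructor
  · rintro ⟨⟨z, hz⟩, -⟩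
    exact ⟨-z, by rw [hz, zero_sub, sub_eq_neg_add]⟩
  · rintro ⟨z, hz⟩
    exact ⟨⟨-z, by rw [hz, zero_sub, neg_neg, sub_neg_eq_add, add_comm]⟩,
      periods_eq_bot_of_bddAbove (hz ▸ bddAbove_Icc)⟩

theorem rightRays_union_doubleRays_eq : α.rightRays ∪ α.doubleRays = component α ''
    {a ∈ α.span | ¬ BddAbove (timeDomain α a) ∧ periods α a = ⊥} := by
  rw [rightRays_eq, doubleRays_eq, ← Set.image_union]
  congr 1
  ext a
  constructor
  · rintro (⟨ha, hB, hA⟩ | ⟨ha, hD, hP⟩)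
    · exact ⟨ha, hA, periods_eq_bot_of_bddBelow hB⟩
    · exact ⟨ha, hD ▸ not_bddAbove_univ, hP⟩
  · rintro ⟨ha, hA, hP⟩
    by_cases hB : BddBelow (timeDomain α a)
    · exact .inl ⟨ha, hB, hA⟩
    · exact .inr ⟨ha, eq_univ_of_ordConnected ordConnected_timeDomain hB hA, hP⟩

theorem disjoint_rightRays_doubleRays : Disjoint α.rightRays α.doubleRays := by
  rw [rightRays_eq, doubleRays_eq]
  refine disjoint_image_component (Set.sep_subset _ _) fun a ⟨_, hB, _⟩ b ⟨_, hD, _⟩ hab => ?_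
  exact not_bddBelow_univ (hD ▸ hab.symm.bddBelow hB)

/-- The chains of length at least `k` contained in `α`. -/
def chainsFrom (α : SymInv X) (k : ℕ) : Set (SymInv X) := ⋃ i, α.chains (k + i)

theorem chainsFrom_eq (hk : 1 ≤ k) : α.chainsFrom k = component α ''
    {a ∈ α.span | BddAbove (timeDomain α a) ∧ BddBelow (timeDomain α a) ∧
      ∃ z ∈ timeDomain α a, z + k ∈ timeDomain α a} := by
  rw [chainsFrom, Set.iUnion_congr fun i => chains_eq (hk.trans (Nat.le_add_right k i)),
    ← Set.image_iUnion]
  congr 1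
  ext a
  rw [Set.mem_iUnion]
  constructor
  · rintro ⟨i, ha, z, hz⟩
    rw [Set.mem_ofPred_eq, hz]
    exact ⟨ha, bddAbove_Icc, bddBelow_Icc, z, ⟨by omega, by omega⟩, ⟨by omega, by omega⟩⟩
  · rintro ⟨ha, hA, hB, z, hz, hzk⟩
    obtain ⟨m, n, hmn⟩ :=
      exists_eq_Icc_of_ordConnected ordConnected_timeDomain ⟨z, hz⟩ hB hA
    rw [hmn, Set.mem_Icc] at hz hzk
    obtain ⟨i, rfl⟩ := Int.le.dest (by omega : m + k ≤ n)
    exact ⟨i, ha, m, by rw [hmn, Nat.cast_add, add_assoc]⟩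

theorem leftRays_union_chainsFrom_eq (hk : 1 ≤ k) : α.leftRays ∪ α.chainsFrom k = component α ''
    {a ∈ α.span | BddAbove (timeDomain α a) ∧
      ∃ z ∈ timeDomain α a, z + k ∈ timeDomain α a} := by
  rw [leftRays_eq, chainsFrom_eq hk, ← Set.image_union]
  congr 1
  ext a
  constructor
  · rintro (⟨ha, hA, hB⟩ | ⟨ha, hA, -, h⟩)
    · obtain ⟨z, hz, hzk⟩ := not_bddBelow_iff.1 hB (-k)
      refine ⟨ha, hA, z, hz, ordConnected_timeDomain.out hz zero_mem_timeDomain ⟨?_, ?_⟩⟩ <;> omega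
    · exact ⟨ha, hA, h⟩
  · rintro ⟨ha, hA, h⟩
    by_cases hB : BddBelow (timeDomain α a)
    · exact .inr ⟨ha, hA, hB, h⟩
    · exact .inl ⟨ha, hA, hB⟩

theorem disjoint_leftRays_chainsFrom (hk : 1 ≤ k) : Disjoint α.leftRays (α.chainsFrom k) := by
  rw [leftRays_eq, chainsFrom_eq hk]
  exact disjoint_image_component (Set.sep_subset _ _) fun a ⟨_, _, hB⟩ b ⟨_, _, hB', _⟩ hab =>
    hB (hab.bddBelow hB')

end Decomposition

section Conjugacy

variable {X : Type*} {α β γ : SymInv X} {a b c d : X} {k : ℕ} {z : ℤ}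

/-- `γ` maps the functional graph of `α` into that of `β`, sending last points of orbits to last
points. This is what conjugacy asks of its two witnesses, see `cConj_iff`. -/
def Intertwines (α β γ : SymInv X) : Prop := α.im ⊆ γ.dom ∧ α * γ = γ * β

theorem mem_conjugatorSet_iff (hα : α ≠ 0) : γ ∈ conjugatorSet α ↔ α.im ⊆ γ.dom := by
  constructor
  · rintro ⟨-, h⟩ y ⟨x, hxy⟩
    classical
    have hμα : (PEquiv.single x x * α : SymInv X) = PEquiv.single x y :=
      PEquiv.single_trans_of_mem x hxy
    have hμαγ := h hα (PEquiv.single x x) (hμα ▸ ne_zero_iff.2 ⟨x, y, PEquiv.mem_single x y⟩)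
    by_contra hy
    exact hμαγ (hμα ▸ PEquiv.single_trans_of_eq_none x
      (Option.eq_none_iff_forall_not_mem.2 fun z hz => hy ⟨z, hz⟩))
  · intro h
    refine ⟨fun h0 => absurd h0 hα, fun _ μ hμ => ?_⟩
    obtain ⟨a, b, hb⟩ := ne_zero_iff.1 hμ
    obtain ⟨b', -, hb'⟩ := mem_mul.1 hb
    obtain ⟨c, hc⟩ := h ⟨b', hb'⟩
    exact ne_zero_iff.2 ⟨a, c, mem_mul.2 ⟨b, hb, hc⟩⟩

theorem mem_conjugatorSetOne_iff (hα : α ≠ 0) : γ ∈ conjugatorSetOne α ↔ α.im ⊆ γ.dom := by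
  rw [conjugatorSetOne, Set.mem_union, mem_conjugatorSet_iff hα, or_iff_left_iff_imp]
  rintro rfl a -
  exact ⟨a, mem_one.2 rfl⟩

theorem exists_mem_conjugatorSetOne_iff :
    (∃ γ ∈ conjugatorSetOne α, α * γ = γ * β) ↔ ∃ γ, Intertwines α β γ := by
  rcases eq_or_ne α 0 with rfl | hα
  · have him : (0 : SymInv X).im ⊆ (0 : SymInv X).dom := fun _ ⟨_, h⟩ => absurd h notMem_zero
    exact iff_of_true ⟨0, .inl ⟨fun _ => rfl, fun h => absurd rfl h⟩, by simp only [zero_mul]⟩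
      ⟨0, him, by simp only [zero_mul]⟩
  · simp only [mem_conjugatorSetOne_iff hα, Intertwines]

theorem cConj_iff : CConj α β ↔ (∃ γ, Intertwines α β γ) ∧ ∃ γ, Intertwines β α γ := by
  simp only [← exists_mem_conjugatorSetOne_iff, CConj]
  exact ⟨fun ⟨g, hg, h, hh, h₁, h₂⟩ => ⟨⟨g, hg, h₁⟩, h, hh, h₂⟩,
    fun ⟨⟨g, hg, h₁⟩, h, hh, h₂⟩ => ⟨g, hg, h, hh, h₁, h₂⟩⟩

/-- The map `sα^z ↦ tβ^z` is a well defined embedding of the orbit of `s` under `α` into that of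
`t` under `β`, and it sends a last point to a last point. -/
structure OrbitEmbeds (α β : SymInv X) (s t : X) : Prop where
  timeDomain_subset : timeDomain α s ⊆ timeDomain β t
  mem_of_nonneg : ∀ z ∈ timeDomain β t, 0 ≤ z → z ∈ timeDomain α s
  periods_eq : periods β t = periods α s

namespace OrbitEmbeds

theorem mem_span (h : OrbitEmbeds α β a c) (ha : a ∈ α.span) : c ∈ β.span :=
  mem_span_iff.2 ((mem_span_iff.1 ha).imp (h.timeDomain_subset ·) (h.timeDomain_subset ·))

theorem bddAbove_iff (h : OrbitEmbeds α β a c) :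
    BddAbove (timeDomain β c) ↔ BddAbove (timeDomain α a) := by
  refine ⟨.mono h.timeDomain_subset, fun ⟨m, hm⟩ => ⟨max m 0, fun z hz => ?_⟩⟩
  rcases le_total z 0 with h0 | h0
  · exact le_max_of_le_right h0
  · exact le_max_of_le_left (hm (h.mem_of_nonneg z hz h0))

end OrbitEmbeds

namespace Intertwines

theorem exists_mem_of_mem (h : Intertwines α β γ) (hc : c ∈ γ a) (hb : b ∈ α a) :
    ∃ d ∈ β c, d ∈ γ b := by
  obtain ⟨d, hd⟩ := h.1 ⟨a, hb⟩
  obtain ⟨c', hc', hd'⟩ := mem_mul.1 (h.2 ▸ mem_mul.2 ⟨b, hb, hd⟩ : d ∈ (γ * β) a)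
  exact ⟨d, Option.mem_unique hc' hc ▸ hd', hd⟩

theorem exists_mem_inv_of_mem (h : Intertwines α β γ) (hc : c ∈ γ a) (hb : a ∈ α b) :
    ∃ d, c ∈ β d ∧ d ∈ γ b := by
  obtain ⟨d, hd, hdc⟩ := mem_mul.1 (h.2 ▸ mem_mul.2 ⟨a, hb, hc⟩ : c ∈ (γ * β) b)
  exact ⟨d, hdc, hd⟩

theorem exists_mem_zpow (h : Intertwines α β γ) (hc : c ∈ γ a) (hb : b ∈ (α ^ z) a) :
    ∃ d ∈ (β ^ z) c, d ∈ γ b := by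
  refine mem_zpow_induction (p := fun z b => ∃ d ∈ (β ^ z) c, d ∈ γ b)
    ⟨c, mem_zpow_zero.2 rfl, hc⟩ (fun z b b' ⟨d, hd, hbd⟩ hb' => ?_)
    (fun z b b' ⟨d, hd, hbd⟩ hb' => ?_) hb
  · obtain ⟨d', hd', hbd'⟩ := h.exists_mem_of_mem hbd hb'
    exact ⟨d', mem_zpow_add_one hd hd', hbd'⟩
  · obtain ⟨d', hd', hbd'⟩ := h.exists_mem_inv_of_mem hbd hb'
    exact ⟨d', mem_zpow_sub_one hd hd', hbd'⟩

theorem exists_mem_pow_symm (h : Intertwines α β γ) (hc : c ∈ γ a) {n : ℕ} (hd : d ∈ (β ^ n) c) :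
    ∃ b ∈ (α ^ n) a, d ∈ γ b := by
  refine mem_pow_induction (p := fun n d => ∃ b ∈ (α ^ n) a, d ∈ γ b)
    ⟨a, by rw [pow_zero, mem_one], hc⟩ (fun n d d' ⟨b, hb, hbd⟩ hd' => ?_) hd
  obtain ⟨b', hb', hbd'⟩ := mem_mul.1 (h.2 ▸ mem_mul.2 ⟨d, hbd, hd'⟩ : d' ∈ (α * γ) b)
  exact ⟨b', by rw [pow_succ]; exact mem_mul.2 ⟨b, hb, hb'⟩, hbd'⟩

theorem exists_mem_zpow_symm (h : Intertwines α β γ) (hc : c ∈ γ a) (hz : 0 ≤ z)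
    (hd : d ∈ (β ^ z) c) : ∃ b ∈ (α ^ z) a, d ∈ γ b := by
  lift z to ℕ using hz
  rw [zpow_natCast] at hd ⊢
  exact h.exists_mem_pow_symm hc hd

theorem sameOrbit (h : Intertwines α β γ) (hc : c ∈ γ a) (hd : d ∈ γ b)
    (hs : SameOrbit β c d) : SameOrbit α a b := by
  obtain ⟨z, hz⟩ := hs
  rcases le_total 0 z with h0 | h0
  · obtain ⟨b', hb', hbd'⟩ := h.exists_mem_zpow_symm hc h0 hz
    exact ⟨z, γ.inj hbd' hd ▸ hb'⟩
  · obtain ⟨a', ha', hac'⟩ := h.exists_mem_zpow_symm hd (neg_nonneg.2 h0) (mem_zpow_neg.2 hz)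
    exact SameOrbit.symm ⟨-z, γ.inj hac' hc ▸ ha'⟩

theorem mem_periods_of_nonneg (h : Intertwines α β γ) (hc : c ∈ γ a) (hz : 0 ≤ z)
    (hp : z ∈ periods β c) : z ∈ periods α a := by
  obtain ⟨b, hb, hbc⟩ := h.exists_mem_zpow_symm hc hz hp
  exact mem_periods.2 (γ.inj hbc hc ▸ hb)

theorem orbitEmbeds (h : Intertwines α β γ) (hc : c ∈ γ a) : OrbitEmbeds α β a c where
  timeDomain_subset z := fun ⟨b, hb⟩ => (h.exists_mem_zpow hc hb).imp fun _ hd => hd.1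
  mem_of_nonneg z := fun ⟨d, hd⟩ hz =>
    (h.exists_mem_zpow_symm hc hz hd).imp fun _ hb => hb.1
  periods_eq := by
    ext z
    refine ⟨fun hz => ?_, fun hz => ?_⟩
    · rcases le_total 0 z with h0 | h0
      · exact h.mem_periods_of_nonneg hc h0 hz
      · exact neg_mem_iff.1 (h.mem_periods_of_nonneg hc (neg_nonneg.2 h0) (neg_mem hz))
    · obtain ⟨d, hd, had⟩ := h.exists_mem_zpow hc (mem_periods.1 hz)
      exact mem_periods.2 (Option.mem_unique had hc ▸ hd)

theorem exists_mem_of_mem_span (h : Intertwines α β γ) (ha : a ∈ α.span) : ∃ c, c ∈ γ a := by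
  rcases ha with ⟨b, hb⟩ | ha
  · obtain ⟨c, hc⟩ := h.1 ⟨a, hb⟩
    exact (h.exists_mem_inv_of_mem hc hb).imp fun _ hd => hd.2
  · exact h.1 ha

theorem mk_image_component_le (h : Intertwines α β γ) {s t : Set X} (hs : s ⊆ α.span)
    (hst : ∀ a ∈ s, ∀ c, OrbitEmbeds α β a c → c ∈ t) :
    #(component α '' s) ≤ #(component β '' t) := by
  have hγ : ∀ η : component α '' s, ∃ a ∈ s, component α a = η ∧ ∃ c, c ∈ γ a := by
    rintro ⟨_, a, ha, rfl⟩
    exact ⟨a, ha, rfl, h.exists_mem_of_mem_span (hs ha)⟩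
  choose a ha hηa c hc using hγ
  refine Cardinal.mk_le_of_injective (f := fun η =>
    ⟨component β (c η), c η, hst _ (ha η) _ (h.orbitEmbeds (hc η)), rfl⟩) fun η θ hηθ => ?_
  have hcspan : c η ∈ β.span := (h.orbitEmbeds (hc η)).mem_span (hs (ha η))
  have hsame := sameOrbit_of_component_eq hcspan (congrArg Subtype.val hηθ)
  rw [Subtype.ext_iff, ← hηa η, ← hηa θ, (h.sameOrbit (hc θ) (hc η) hsame).component_eq]

theorem mk_cycles_le (h : Intertwines α β γ) (hk : 1 ≤ k) : #(α.cycles k) ≤ #(β.cycles k) := by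
  rw [cycles_eq hk, cycles_eq hk]
  exact h.mk_image_component_le (Set.sep_subset _ _) fun a ⟨ha, hp⟩ c hac =>
    ⟨hac.mem_span ha, hac.periods_eq.trans hp⟩

theorem mk_doubleRays_le (h : Intertwines α β γ) : #α.doubleRays ≤ #β.doubleRays := by
  rw [doubleRays_eq, doubleRays_eq]
  exact h.mk_image_component_le (Set.sep_subset _ _) fun a ⟨ha, hD, hp⟩ c hac =>
    ⟨hac.mem_span ha, Set.univ_subset_iff.1 (hD ▸ hac.timeDomain_subset), hac.periods_eq.trans hp⟩

theorem mk_leftRays_le (h : Intertwines α β γ) : #α.leftRays ≤ #β.leftRays := by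
  rw [leftRays_eq, leftRays_eq]
  exact h.mk_image_component_le (Set.sep_subset _ _) fun a ⟨ha, hA, hB⟩ c hac =>
    ⟨hac.mem_span ha, hac.bddAbove_iff.2 hA, fun hB' => hB (hB'.mono hac.timeDomain_subset)⟩

theorem mk_rightRays_union_doubleRays_le (h : Intertwines α β γ) :
    #↑(α.rightRays ∪ α.doubleRays) ≤ #↑(β.rightRays ∪ β.doubleRays) := by
  rw [rightRays_union_doubleRays_eq, rightRays_union_doubleRays_eq]
  exact h.mk_image_component_le (Set.sep_subset _ _) fun a ⟨ha, hA, hp⟩ c hac =>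
    ⟨hac.mem_span ha, mt hac.bddAbove_iff.1 hA, hac.periods_eq.trans hp⟩

theorem mk_leftRays_union_chainsFrom_le (h : Intertwines α β γ) (hk : 1 ≤ k) :
    #↑(α.leftRays ∪ α.chainsFrom k) ≤ #↑(β.leftRays ∪ β.chainsFrom k) := by
  rw [leftRays_union_chainsFrom_eq hk, leftRays_union_chainsFrom_eq hk]
  exact h.mk_image_component_le (Set.sep_subset _ _) fun a ⟨ha, hA, z, hz, hzk⟩ c hac =>
    ⟨hac.mem_span ha, hac.bddAbove_iff.2 hA, z, hac.timeDomain_subset hz,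
      hac.timeDomain_subset hzk⟩

end Intertwines

end Conjugacy

section Matching

variable {ι M N : Type*} {P : M → N → Prop} {A A' : Set M} {B B' : Set N}

/-- There is an injection from `A` to `B` that respects the relation `P`. -/
def HasMatching (P : M → N → Prop) (A : Set M) (B : Set N) : Prop :=
  ∃ f : A → B, Function.Injective f ∧ ∀ a : A, P a (f a)

theorem exists_injective_mem_of_infinite [Countable ι] {S : ι → Set N} (hS : ∀ i, (S i).Infinite) :
    ∃ f : ι → N, Function.Injective f ∧ ∀ i, f i ∈ S i := by
  classical
  obtain ⟨e, he⟩ := exists_injective_nat ι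
  choose T hTS hT using fun i => (hS i).exists_subset_card_eq (e i + 1)
  obtain ⟨f, hf, hfT⟩ := (Finset.all_card_le_biUnion_card_iff_exists_injective T).1 fun s => by
    rcases s.eq_empty_or_nonempty with rfl | hs
    · exact Nat.zero_le _
    obtain ⟨i, hi, hmax⟩ := s.exists_max_image e hs
    calc s.card ≤ (Finset.range (e i + 1)).card := Finset.card_le_card_of_injOn e
          (fun j hj => Finset.mem_coe.2 (Finset.mem_range_succ_iff.2 (hmax j hj))) he.injOn
      _ = (T i).card := by rw [Finset.card_range, hT]
      _ ≤ (s.biUnion T).card := Finset.card_le_card (Finset.subset_biUnion_of_mem T hi)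
  exact ⟨f, hf, fun i => hTS i (hfT i)⟩

namespace HasMatching

theorem mono (hA : A' ⊆ A) (hB : B ⊆ B') : HasMatching P A B → HasMatching P A' B'
  | ⟨f, hf, hP⟩ => ⟨Set.inclusion hB ∘ f ∘ Set.inclusion hA,
      (Set.inclusion_injective hB).comp (hf.comp (Set.inclusion_injective hA)),
      fun a => hP (Set.inclusion hA a)⟩

theorem of_infinite (hA : A.Countable) (h : ∀ a ∈ A, {b ∈ B | P a b}.Infinite) :
    HasMatching P A B := by
  have := hA.to_subtype
  obtain ⟨f, hf, hfP⟩ := exists_injective_mem_of_infinite fun a : A => h a a.2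
  exact ⟨fun a => ⟨f a, (hfP a).1⟩, fun a b hab => hf (congrArg Subtype.val hab),
    fun a => (hfP a).2⟩

theorem of_forall_of_infinite (hA : A.Countable) (hB : B.Infinite) (h : ∀ a ∈ A, ∀ b ∈ B, P a b) :
    HasMatching P A B :=
  of_infinite hA fun a ha => hB.mono fun b hb => ⟨hb, h a ha b hb⟩

theorem iUnion {A : ι → Set M} {B : ι → Set N} (h : ∀ i, HasMatching P (A i) (B i))
    (hB : Pairwise fun i j => Disjoint (B i) (B j)) : HasMatching P (⋃ i, A i) (⋃ i, B i) := by
  choose f hf hP using h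
  choose i hi using fun a : ⋃ i, A i => Set.mem_iUnion.1 a.2
  have hinj : ∀ j k (a : A j) (b : A k), (f j a : N) = f k b → (a : M) = b := by
    intro j k a b hab
    obtain rfl := hB.eq (Set.not_disjoint_iff.2 ⟨f j a, (f j a).2, hab ▸ (f k b).2⟩)
    exact congrArg Subtype.val (hf j (Subtype.ext hab))
  exact ⟨fun a => ⟨f (i a) ⟨a, hi a⟩, Set.mem_iUnion_of_mem _ (Subtype.mem _)⟩,
    fun a b hab => Subtype.ext (hinj _ _ ⟨a, hi a⟩ ⟨b, hi b⟩ (Subtype.ext_iff.1 hab)),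
    fun a => hP (i a) ⟨a, hi a⟩⟩

theorem union (h : HasMatching P A B) (h' : HasMatching P A' B') (hB : Disjoint B B') :
    HasMatching P (A ∪ A') (B ∪ B') := by
  rw [Set.union_eq_iUnion, Set.union_eq_iUnion]
  exact iUnion (Bool.forall_bool.2 ⟨h', h⟩) ((pairwise_disjoint_on_bool).2 hB)

end HasMatching

universe u in
theorem HasMatching.of_mk_eq {M N : Type u} {P : M → N → Prop} {A : Set M} {B : Set N}
    (h : #A = #B) (hP : ∀ a ∈ A, ∀ b ∈ B, P a b) : HasMatching P A B := by
  obtain ⟨e⟩ := Cardinal.eq.1 h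
  exact ⟨e, e.injective, fun a => hP a a.2 _ (e a).2⟩

end Matching

section Embeddings

variable {X : Type*} {α β η θ : SymInv X} {a b c d s t : X} {j k : ℕ} {z : ℤ}

/-- The map `sα^z ↦ tβ^z` from the orbit of `s` to that of `t` sends `a` to `b`. -/
def Follows (α β : SymInv X) (s t a b : X) : Prop := ∃ z : ℤ, a ∈ (α ^ z) s ∧ b ∈ (β ^ z) t

theorem Follows.symm : Follows α β s t a b → Follows β α t s b a
  | ⟨z, ha, hb⟩ => ⟨z, hb, ha⟩

theorem Follows.sameOrbit : Follows α β s t a b → SameOrbit α s a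
  | ⟨z, ha, _⟩ => ⟨z, ha⟩

theorem Follows.unique (hp : periods α s ≤ periods β t) :
    Follows α β s t a b → Follows α β s t a c → b = c
  | ⟨_, ha, hb⟩, ⟨_, ha', hc⟩ => Option.mem_unique
      ((zpow_mem_iff_sub_mem_periods hb).2 (hp ((zpow_mem_iff_sub_mem_periods ha).1 ha'))) hc

namespace OrbitEmbeds

theorem exists_follows (h : OrbitEmbeds α β s t) : SameOrbit α s a → ∃ b, Follows α β s t a b
  | ⟨z, ha⟩ => (h.timeDomain_subset ⟨a, ha⟩).imp fun _ hb => ⟨z, ha, hb⟩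

theorem follows_pred (h : OrbitEmbeds α β s t) (hc : c ∈ α a) (hd : Follows α β s t c d) :
    ∃ b, Follows α β s t a b ∧ d ∈ β b := by
  obtain ⟨z, hcs, hdt⟩ := hd
  have ha := mem_zpow_sub_one hcs hc
  obtain ⟨b, hb⟩ := h.timeDomain_subset ⟨a, ha⟩
  exact ⟨b, ⟨z - 1, ha, hb⟩, mem_zpow_one.1 (sub_sub_cancel z 1 ▸ mem_zpow_sub hb hdt)⟩

theorem follows_succ (h : OrbitEmbeds α β s t) (hb : Follows α β s t a b) (hd : d ∈ β b) :
    ∃ c ∈ α a, Follows α β s t c d := by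
  obtain ⟨z, ha, hb⟩ := hb
  have hdt := mem_zpow_add_one hb hd
  have hz : z + 1 ∈ timeDomain α s := by
    rcases le_total 0 (z + 1) with h0 | h0
    · exact h.mem_of_nonneg _ ⟨d, hdt⟩ h0
    · exact ordConnected_timeDomain.out ⟨a, ha⟩ zero_mem_timeDomain ⟨by omega, h0⟩
  obtain ⟨c, hc⟩ := hz
  exact ⟨c, mem_zpow_one.1 (add_sub_cancel_left z 1 ▸ mem_zpow_sub ha hc), z + 1, hc, hdt⟩

theorem of_periods_ne_bot (hp : periods β t = periods α s) (h : periods α s ≠ ⊥) :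
    OrbitEmbeds α β s t := by
  have hs := timeDomain_eq_univ_of_periods_ne_bot h
  exact ⟨fun z _ => timeDomain_eq_univ_of_periods_ne_bot (hp ▸ h) ▸ Set.mem_univ z,
    fun z _ _ => hs ▸ Set.mem_univ z, hp⟩

theorem of_eq_univ (hs : ¬ BddAbove (timeDomain α s)) (ht : timeDomain β t = Set.univ)
    (hp : periods β t = periods α s) : OrbitEmbeds α β s t := by
  refine ⟨ht ▸ Set.subset_univ _, fun z _ hz => ?_, hp⟩
  obtain ⟨w, hw, hzw⟩ := not_bddAbove_iff.1 hs z
  exact mem_timeDomain_of_le hz hzw.le hw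

theorem of_isGreatest_zero (hs : IsGreatest (timeDomain α s) 0)
    (ht : IsGreatest (timeDomain β t) 0) (hst : timeDomain α s ⊆ timeDomain β t) :
    OrbitEmbeds α β s t where
  timeDomain_subset := hst
  mem_of_nonneg _ hz h0 := (ht.2 hz).antisymm h0 ▸ hs.1
  periods_eq := (periods_eq_bot_of_bddAbove ⟨0, ht.2⟩).trans
    (periods_eq_bot_of_bddAbove ⟨0, hs.2⟩).symm

end OrbitEmbeds

/-- The component `η` of `α` can be mapped into the component `θ` of `β` in an intertwining way. -/
def ComponentEmbeds (α β η θ : SymInv X) : Prop :=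
  ∃ s ∈ α.span, ∃ t, component α s = η ∧ component β t = θ ∧ OrbitEmbeds α β s t

theorem exists_mem_iff_of_biUnique {R : X → X → Prop} (hR : Relator.BiUnique R) :
    ∃ γ : SymInv X, ∀ a b, b ∈ γ a ↔ R a b := by
  have hfun : ∀ {R : X → X → Prop}, Relator.RightUnique R →
      ∀ a, ∃ o : Option X, ∀ b, b ∈ o ↔ R a b := by
    intro R hR a
    by_cases h : ∃ b, R a b
    · obtain ⟨b, hb⟩ := h
      exact ⟨some b, fun c => ⟨fun hc => Option.some_inj.1 hc ▸ hb, fun hc => hR hb hc ▸ rfl⟩⟩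
    · exact ⟨none, fun b => iff_of_false (Option.not_mem_none b) fun hb => h ⟨b, hb⟩⟩
  choose f hf using hfun hR.2
  choose g hg using hfun (R := flip R) fun _ _ _ h h' => hR.1 h h'
  exact ⟨⟨f, g, fun a b => (hg b a).trans (hf a b).symm⟩, hf⟩

theorem exists_intertwines {B : Set (SymInv X)}
    (h : HasMatching (ComponentEmbeds α β) (component α '' α.span) B) :
    ∃ γ, Intertwines α β γ := by
  obtain ⟨f, hf, hfst⟩ := h
  choose s hs t hsη htη hst using hfst
  have hR : Relator.BiUnique fun a b => ∃ η, Follows α β (s η) (t η) a b := by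
    constructor
    · rintro a c b ⟨η, ha⟩ ⟨θ, hb⟩
      have h1 := (ha.symm.sameOrbit.trans hb.symm.sameOrbit.symm).component_eq
      rw [htη η, htη θ] at h1
      obtain rfl := hf (Subtype.ext h1)
      exact ha.symm.unique (hst η).periods_eq.le hb.symm
    · rintro a b c ⟨η, hb⟩ ⟨θ, hc⟩
      have h1 := (hb.sameOrbit.trans hc.sameOrbit.symm).component_eq
      rw [hsη η, hsη θ] at h1
      obtain rfl := Subtype.ext h1
      exact hb.unique (hst η).periods_eq.ge hc
  obtain ⟨γ, hγ⟩ := exists_mem_iff_of_biUnique hR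
  refine ⟨γ, fun a ha => ?_, ext_mem fun a d => ?_⟩
  · let η : component α '' α.span := ⟨component α a, a, .inr ha, rfl⟩
    obtain ⟨b, hb⟩ := (hst η).exists_follows (sameOrbit_of_component_eq (hs η) (hsη η)).symm
    exact ⟨b, (hγ a b).2 ⟨η, hb⟩⟩
  · simp only [mem_mul, hγ]
    constructor
    · rintro ⟨c, hc, η, hd⟩
      obtain ⟨b, hb, hd⟩ := (hst η).follows_pred hc hd
      exact ⟨b, ⟨η, hb⟩, hd⟩
    · rintro ⟨b, ⟨η, hb⟩, hd⟩
      obtain ⟨c, hc, hd⟩ := (hst η).follows_succ hb hd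
      exact ⟨c, hc, η, hd⟩

end Embeddings

section ComponentMatchings

variable {X : Type*} {α β η θ : SymInv X} {a b : X} {j k : ℕ} {z : ℤ}

theorem exists_component_eq_of_mem (ha : a ∈ α.span) (hz : z ∈ timeDomain α a) :
    ∃ s ∈ α.span, component α s = component α a ∧
      timeDomain α s = (z + ·) ⁻¹' timeDomain α a := by
  obtain ⟨s, hs⟩ := hz
  have hab : SameOrbit α a s := ⟨z, hs⟩
  exact ⟨s, hab.mem_span ha, hab.component_eq.symm, timeDomain_eq_preimage_of_mem hs⟩

theorem exists_timeDomain_eq_Ici (hη : η ∈ α.rightRays) :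
    ∃ s ∈ α.span, component α s = η ∧ timeDomain α s = Set.Ici 0 := by
  rw [rightRays_eq] at hη
  obtain ⟨a, ⟨ha, hB, hA⟩, rfl⟩ := hη
  obtain ⟨z, hz⟩ :=
    exists_eq_Ici_of_ordConnected ordConnected_timeDomain ⟨0, zero_mem_timeDomain⟩ hB hA
  obtain ⟨s, hs, hsa, hD⟩ := exists_component_eq_of_mem ha (hz ▸ Set.self_mem_Ici)
  exact ⟨s, hs, hsa, by rw [hD, hz, Set.preimage_const_add_Ici, sub_self]⟩

theorem exists_timeDomain_eq_Iic (hη : η ∈ α.leftRays) :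
    ∃ s ∈ α.span, component α s = η ∧ timeDomain α s = Set.Iic 0 := by
  rw [leftRays_eq] at hη
  obtain ⟨a, ⟨ha, hA, hB⟩, rfl⟩ := hη
  obtain ⟨z, hz⟩ :=
    exists_eq_Iic_of_ordConnected ordConnected_timeDomain ⟨0, zero_mem_timeDomain⟩ hB hA
  obtain ⟨s, hs, hsa, hD⟩ := exists_component_eq_of_mem ha (hz ▸ Set.self_mem_Iic)
  exact ⟨s, hs, hsa, by rw [hD, hz, Set.preimage_const_add_Iic, sub_self]⟩

theorem exists_timeDomain_eq_Icc (hk : 1 ≤ k) (hη : η ∈ α.chains k) :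
    ∃ s ∈ α.span, component α s = η ∧ timeDomain α s = Set.Icc (-k : ℤ) 0 := by
  rw [chains_eq hk] at hη
  obtain ⟨a, ⟨ha, z, hz⟩, rfl⟩ := hη
  obtain ⟨s, hs, hsa, hD⟩ := exists_component_eq_of_mem (z := z + k) ha
    (hz ▸ Set.right_mem_Icc.2 (by omega))
  exact ⟨s, hs, hsa, by rw [hD, hz, Set.preimage_const_add_Icc, sub_self, sub_add_cancel_left]⟩

theorem exists_isGreatest_timeDomain (hη : η ∈ α.leftRays ∪ α.chainsFrom 1) :
    ∃ s ∈ α.span, component α s = η ∧ IsGreatest (timeDomain α s) 0 := by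
  rcases hη with hη | hη
  · obtain ⟨s, hs, hsη, hD⟩ := exists_timeDomain_eq_Iic hη
    exact ⟨s, hs, hsη, hD ▸ isGreatest_Iic⟩
  · obtain ⟨i, hη⟩ := Set.mem_iUnion.1 hη
    obtain ⟨s, hs, hsη, hD⟩ := exists_timeDomain_eq_Icc (Nat.le_add_right 1 i) hη
    exact ⟨s, hs, hsη, hD ▸ isGreatest_Icc (by omega)⟩

namespace ComponentEmbeds

theorem of_mem_cycles (hk : 1 ≤ k) (hη : η ∈ α.cycles k) (hθ : θ ∈ β.cycles k) :
    ComponentEmbeds α β η θ := by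
  rw [cycles_eq hk] at hη hθ
  obtain ⟨a, ⟨ha, hpa⟩, rfl⟩ := hη
  obtain ⟨b, ⟨-, hpb⟩, rfl⟩ := hθ
  refine ⟨a, ha, b, rfl, rfl, .of_periods_ne_bot (hpb.trans hpa.symm) ?_⟩
  rw [hpa, Ne, AddSubgroup.zmultiples_eq_bot]
  omega

theorem of_mem_doubleRays (hη : η ∈ α.rightRays ∪ α.doubleRays) (hθ : θ ∈ β.doubleRays) :
    ComponentEmbeds α β η θ := by
  rw [rightRays_union_doubleRays_eq] at hη
  rw [doubleRays_eq] at hθ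
  obtain ⟨a, ⟨ha, hA, hpa⟩, rfl⟩ := hη
  obtain ⟨b, ⟨-, hD, hpb⟩, rfl⟩ := hθ
  exact ⟨a, ha, b, rfl, rfl, .of_eq_univ hA hD (hpb.trans hpa.symm)⟩

theorem of_mem_rightRays (hη : η ∈ α.rightRays) (hθ : θ ∈ β.rightRays) :
    ComponentEmbeds α β η θ := by
  obtain ⟨s, hs, hsη, hDs⟩ := exists_timeDomain_eq_Ici hη
  obtain ⟨t, -, htθ, hDt⟩ := exists_timeDomain_eq_Ici hθ
  have hD : timeDomain β t = timeDomain α s := hDt.trans hDs.symm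
  refine ⟨s, hs, t, hsη, htθ, hD.ge, fun z hz _ => hD ▸ hz, ?_⟩
  rw [periods_eq_bot_of_bddBelow (hDt ▸ bddBelow_Ici),
    periods_eq_bot_of_bddBelow (hDs ▸ bddBelow_Ici)]

theorem of_mem_leftRays (hη : η ∈ α.leftRays ∪ α.chainsFrom 1) (hθ : θ ∈ β.leftRays) :
    ComponentEmbeds α β η θ := by
  obtain ⟨s, hs, hsη, hDs⟩ := exists_isGreatest_timeDomain hη
  obtain ⟨t, -, htθ, hDt⟩ := exists_timeDomain_eq_Iic hθ
  exact ⟨s, hs, t, hsη, htθ, .of_isGreatest_zero hDs (hDt ▸ isGreatest_Iic) (hDt ▸ hDs.2)⟩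

theorem of_mem_chains (hj : 1 ≤ j) (hjk : j ≤ k) (hη : η ∈ α.chains j) (hθ : θ ∈ β.chains k) :
    ComponentEmbeds α β η θ := by
  obtain ⟨s, hs, hsη, hDs⟩ := exists_timeDomain_eq_Icc hj hη
  obtain ⟨t, -, htθ, hDt⟩ := exists_timeDomain_eq_Icc (hj.trans hjk) hθ
  exact ⟨s, hs, t, hsη, htθ, .of_isGreatest_zero (hDs ▸ isGreatest_Icc (by omega))
    (hDt ▸ isGreatest_Icc (by omega)) (hDs ▸ hDt ▸ Set.Icc_subset_Icc_left (by omega))⟩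

end ComponentEmbeds

theorem disjoint_cycles (hj : 1 ≤ j) (hk : 1 ≤ k) (hjk : j ≠ k) :
    Disjoint (α.cycles j) (α.cycles k) := by
  rw [cycles_eq hj, cycles_eq hk]
  refine disjoint_image_component (Set.sep_subset _ _) fun a ⟨_, ha⟩ b ⟨_, hb⟩ hab => hjk ?_
  rw [hab.periods_eq, hb] at ha
  exact Nat.dvd_antisymm
    (Int.natCast_dvd_natCast.1 (Int.mem_zmultiples_iff.1 (ha.le (AddSubgroup.mem_zmultiples _))))
    (Int.natCast_dvd_natCast.1 (Int.mem_zmultiples_iff.1 (ha.ge (AddSubgroup.mem_zmultiples _))))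

theorem disjoint_cycles_rays_union_chainsFrom (hk : 1 ≤ k) : Disjoint (α.cycles k)
    ((α.rightRays ∪ α.doubleRays) ∪ (α.leftRays ∪ α.chainsFrom 1)) := by
  rw [cycles_eq hk, rightRays_union_doubleRays_eq, leftRays_union_chainsFrom_eq le_rfl,
    ← Set.image_union]
  refine disjoint_image_component (Set.sep_subset _ _) fun a ⟨_, ha⟩ b hb hab => ?_
  have hpb : periods α b = ⊥ := hb.elim (·.2.2) fun h => periods_eq_bot_of_bddAbove h.2.1
  rw [hab.periods_eq, hpb, eq_comm, AddSubgroup.zmultiples_eq_bot] at ha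
  omega

theorem disjoint_rightRays_union_doubleRays_leftRays_union_chainsFrom :
    Disjoint (α.rightRays ∪ α.doubleRays) (α.leftRays ∪ α.chainsFrom 1) := by
  rw [rightRays_union_doubleRays_eq, leftRays_union_chainsFrom_eq le_rfl]
  exact disjoint_image_component (Set.sep_subset _ _) fun a ⟨_, hA, _⟩ b ⟨_, hA', _⟩ hab =>
    hA (hab.bddAbove hA')

theorem le_of_timeDomain_eq_Icc {w : ℤ} (hab : SameOrbit α a b)
    (ha : timeDomain α a = Set.Icc z (z + j)) (hb : timeDomain α b = Set.Icc w (w + k)) :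
    j ≤ k := by
  obtain ⟨v, hv⟩ := hab
  have h := timeDomain_eq_preimage_of_mem hv
  rw [ha, hb, Set.preimage_const_add_Icc, Set.Icc_eq_Icc_iff (by omega)] at h
  omega

theorem disjoint_chains (hj : 1 ≤ j) (hk : 1 ≤ k) (hjk : j ≠ k) :
    Disjoint (α.chains j) (α.chains k) := by
  rw [chains_eq hj, chains_eq hk]
  exact disjoint_image_component (Set.sep_subset _ _) fun a ⟨_, z, ha⟩ b ⟨_, w, hb⟩ hab =>
    hjk ((le_of_timeDomain_eq_Icc hab.symm ha hb).antisymm (le_of_timeDomain_eq_Icc hab hb ha))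

theorem disjoint_chains_chainsFrom (hk : 1 ≤ k) : Disjoint (α.chains k) (α.chainsFrom (k + 1)) :=
  Set.disjoint_iUnion_right.2 fun _ => disjoint_chains hk (by omega) (by omega)

theorem chainsFrom_eq_union : α.chainsFrom k = α.chains k ∪ α.chainsFrom (k + 1) := by
  simp only [chainsFrom, add_assoc, add_comm 1]
  exact (sup_iSup_nat_succ fun i => α.chains (k + i)).symm

theorem mk_chainsFrom (hk : 1 ≤ k) :
    #(α.chainsFrom k) = #(α.chains k) + #(α.chainsFrom (k + 1)) := by
  rw [chainsFrom_eq_union, mk_union_of_disjoint (disjoint_chains_chainsFrom hk)]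

theorem chains_subset_chainsFrom (h : j ≤ k) : α.chains k ⊆ α.chainsFrom j := by
  obtain ⟨i, rfl⟩ := Nat.exists_eq_add_of_le h
  exact Set.subset_iUnion (fun i => α.chains (j + i)) i

theorem chainsFrom_anti (h : j ≤ k) : α.chainsFrom k ⊆ α.chainsFrom j :=
  Set.iUnion_subset fun _ => chains_subset_chainsFrom (by omega)

theorem image_component_span_subset :
    component α '' α.span ⊆ (⋃ k, α.cycles (k + 1)) ∪
      ((α.rightRays ∪ α.doubleRays) ∪ (α.leftRays ∪ α.chainsFrom 1)) := by
  rintro _ ⟨a, ha, rfl⟩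
  have hc := contains_component ha
  rcases isBasic_component ha with ⟨k, hk⟩ | ⟨k, hk⟩ | hΩ | hΥ | hΛ
  · obtain ⟨i, rfl⟩ := Nat.exists_eq_add_of_le' hk.1
    exact .inl (Set.mem_iUnion.2 ⟨i, hc, hk⟩)
  · exact .inr (.inr (.inr (chains_subset_chainsFrom hk.1 ⟨hc, hk⟩)))
  · exact .inr (.inl (.inr ⟨hc, hΩ⟩))
  · exact .inr (.inl (.inl ⟨hc, hΥ⟩))
  · exact .inr (.inr (.inl ⟨hc, hΛ⟩))

theorem mk_chains_eq_of_mk_chainsFrom_eq (hk : 1 ≤ k)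
    (h : #(α.chainsFrom k) = #(β.chainsFrom k))
    (h' : #(α.chainsFrom (k + 1)) = #(β.chainsFrom (k + 1))) (hfin : (β.chainsFrom k).Finite) :
    #(α.chains k) = #(β.chains k) := by
  rw [mk_chainsFrom hk, mk_chainsFrom hk, h'] at h
  exact Cardinal.eq_of_add_eq_add_right h
    (lt_aleph0_iff_set_finite.2 (hfin.subset (chainsFrom_anti k.le_succ)))

theorem hasMatching_chainsFrom_of_finite (hk : 1 ≤ k)
    (h : ∀ i, k ≤ i → #(α.chainsFrom i) = #(β.chainsFrom i)) (hfin : (β.chainsFrom k).Finite) :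
    HasMatching (ComponentEmbeds α β) (α.chainsFrom k) (β.chainsFrom k) := by
  refine .iUnion (fun i => .of_mk_eq ?_ fun η hη θ hθ => ?_)
    fun i j hij => disjoint_chains (by omega) (by omega) (by omega)
  · exact mk_chains_eq_of_mk_chainsFrom_eq (by omega) (h _ (by omega))
      (h _ (by omega)) (hfin.subset (chainsFrom_anti (by omega)))
  · exact .of_mem_chains (by omega) le_rfl hη hθ

variable [Countable X]

theorem countable_chains (hk : 1 ≤ k) : (α.chains k).Countable :=
  chains_eq (α := α) hk ▸ (Set.to_countable _).image _

theorem countable_chainsFrom (hk : 1 ≤ k) : (α.chainsFrom k).Countable :=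
  Set.countable_iUnion fun _ => countable_chains (by omega)

theorem hasMatching_chainsFrom (h : ∀ k, 1 ≤ k → #(α.chainsFrom k) = #(β.chainsFrom k)) :
    HasMatching (ComponentEmbeds α β) (α.chainsFrom 1) (β.chainsFrom 1) := by
  have hcount := countable_chainsFrom (α := α) le_rfl
  by_cases hfin : ∃ k, 1 ≤ k ∧ (β.chainsFrom k).Finite
  · obtain ⟨k, hk, hfin⟩ := hfin
    induction k, hk using Nat.le_induction with
    | base => exact hasMatching_chainsFrom_of_finite le_rfl h hfin
    | succ k hk ih =>
      by_cases hfin' : (β.chainsFrom k).Finite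
      · exact ih hfin'
      have hinf : (β.chains k).Infinite := fun hc =>
        hfin' (chainsFrom_eq_union (α := β) ▸ hc.union hfin)
      have hlow : HasMatching (ComponentEmbeds α β) (α.chainsFrom 1 \ α.chainsFrom (k + 1))
          (β.chains k) := by
        refine .of_forall_of_infinite (hcount.mono Set.sdiff_subset) hinf fun η ⟨hη, hη'⟩ θ hθ => ?_
        obtain ⟨i, hi⟩ := Set.mem_iUnion.1 hη
        refine .of_mem_chains (Nat.le_add_right 1 i) (not_lt.1 fun hki => ?_) hi hθ
        exact hη' (chains_subset_chainsFrom hki hi)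
      have hhigh := hasMatching_chainsFrom_of_finite (by omega) (fun i hi => h i (by omega)) hfin
      refine (hlow.union hhigh (disjoint_chains_chainsFrom hk)).mono ?_ ?_
      · rw [Set.sdiff_union_self]
        exact Set.subset_union_left
      · rw [← chainsFrom_eq_union]
        exact chainsFrom_anti hk
  · refine .of_infinite hcount fun η hη => ?_
    obtain ⟨i, hi⟩ := Set.mem_iUnion.1 hη
    have hinf : (β.chainsFrom (1 + i)).Infinite := fun hc => hfin ⟨1 + i, by omega, hc⟩
    refine hinf.mono fun θ hθ => ⟨chainsFrom_anti (by omega) hθ, ?_⟩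
    obtain ⟨j, hj⟩ := Set.mem_iUnion.1 hθ
    exact .of_mem_chains (by omega) (Nat.le_add_right _ _) hi hj

theorem hasMatching_leftRays_union_chainsFrom (hΛ : #α.leftRays = #β.leftRays)
    (hΘ : β.leftRays.Finite → ∀ k, 1 ≤ k → #(α.chainsFrom k) = #(β.chainsFrom k)) :
    HasMatching (ComponentEmbeds α β) (α.leftRays ∪ α.chainsFrom 1)
      (β.leftRays ∪ β.chainsFrom 1) := by
  by_cases hfin : β.leftRays.Finite
  · exact .union (.of_mk_eq hΛ fun η hη θ hθ => .of_mem_leftRays (.inl hη) hθ)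
      (hasMatching_chainsFrom (hΘ hfin)) (disjoint_leftRays_chainsFrom le_rfl)
  · rw [leftRays_union_chainsFrom_eq (α := α) le_rfl]
    refine .mono subset_rfl Set.subset_union_left (.of_forall_of_infinite
      ((Set.to_countable _).image _) hfin fun η hη θ hθ => .of_mem_leftRays ?_ hθ)
    rwa [leftRays_union_chainsFrom_eq le_rfl]

theorem hasMatching_rightRays_union_doubleRays (hΩ : #α.doubleRays = #β.doubleRays)
    (hΥ : β.doubleRays.Finite → #α.rightRays = #β.rightRays) :
    HasMatching (ComponentEmbeds α β) (α.rightRays ∪ α.doubleRays)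
      (β.rightRays ∪ β.doubleRays) := by
  by_cases hfin : β.doubleRays.Finite
  · exact .union (.of_mk_eq (hΥ hfin) fun η hη θ hθ => .of_mem_rightRays hη hθ)
      (.of_mk_eq hΩ fun η hη θ hθ => .of_mem_doubleRays (.inr hη) hθ) disjoint_rightRays_doubleRays
  · rw [rightRays_union_doubleRays_eq (α := α)]
    refine .mono subset_rfl Set.subset_union_right (.of_forall_of_infinite
      ((Set.to_countable _).image _) hfin fun η hη θ hθ => .of_mem_doubleRays ?_ hθ)
    rwa [rightRays_union_doubleRays_eq]

theorem exists_intertwines_of_mk_eq (hΔ : ∀ k, 1 ≤ k → #(α.cycles k) = #(β.cycles k))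
    (hΩ : #α.doubleRays = #β.doubleRays) (hΛ : #α.leftRays = #β.leftRays)
    (hΥ : β.doubleRays.Finite → #α.rightRays = #β.rightRays)
    (hΘ : β.leftRays.Finite → ∀ k, 1 ≤ k → #(α.chainsFrom k) = #(β.chainsFrom k)) :
    ∃ γ, Intertwines α β γ := by
  have hcycles : HasMatching (ComponentEmbeds α β)
      (⋃ k, α.cycles (k + 1)) (⋃ k, β.cycles (k + 1)) :=
    .iUnion (fun k => .of_mk_eq (hΔ _ k.succ_pos) fun η hη θ hθ => .of_mem_cycles k.succ_pos hη hθ)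
      fun j k hjk => disjoint_cycles j.succ_pos k.succ_pos (Nat.succ_injective.ne hjk)
  have hrays := (hasMatching_rightRays_union_doubleRays hΩ hΥ).union
    (hasMatching_leftRays_union_chainsFrom hΛ hΘ)
    disjoint_rightRays_union_doubleRays_leftRays_union_chainsFrom
  have hdisj : Disjoint (⋃ k, β.cycles (k + 1))
      ((β.rightRays ∪ β.doubleRays) ∪ (β.leftRays ∪ β.chainsFrom 1)) :=
    Set.disjoint_iUnion_left.2 fun k => disjoint_cycles_rays_union_chainsFrom k.succ_pos
  exact exists_intertwines ((hcycles.union hrays hdisj).mono image_component_span_subset subset_rfl)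

end ComponentMatchings

section ChainInvariants

variable {X : Type*} {α β : SymInv X} {k : ℕ}

theorem natCast_le_maxChain_iff (hk : 1 ≤ k) :
    (k : ℕ∞) ≤ α.maxChain ↔ (α.chainsFrom k).Nonempty := by
  refine ⟨fun h => ?_, fun ⟨θ, hθ⟩ => ?_⟩
  · by_contra hne
    have hle : α.maxChain ≤ ((k - 1 : ℕ) : ℕ∞) := by
      refine iSup₂_le fun j ⟨_, hj⟩ => Nat.cast_le.2 (Nat.le_sub_one_of_lt (not_le.1 fun hkj => ?_))
      exact hne (hj.mono (chains_subset_chainsFrom hkj))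
    have := Nat.cast_le.1 (h.trans hle)
    omega
  · obtain ⟨i, hi⟩ := Set.mem_iUnion.1 hθ
    exact (Nat.cast_le.2 (Nat.le_add_right k i)).trans
      (le_iSup₂_of_le (k + i) ⟨by omega, θ, hi⟩ le_rfl)

theorem chainsFrom_eq_empty (hk : 1 ≤ k) (h : α.maxChain < k) : α.chainsFrom k = ∅ :=
  Set.not_nonempty_iff_eq_empty.1 (mt (natCast_le_maxChain_iff hk).2 h.not_ge)

theorem chainsFrom_infinite (hk : 1 ≤ k) (h : α.maxChain = ⊤) : (α.chainsFrom k).Infinite := by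
  intro hfin
  have hev : ∀ᶠ j in Filter.atTop, ∀ θ ∈ α.chainsFrom k, θ ∉ α.chainsFrom j := by
    refine (Filter.eventually_all_finite hfin).2 fun θ hθ => ?_
    obtain ⟨i, hi⟩ := Set.mem_iUnion.1 hθ
    filter_upwards [Filter.eventually_gt_atTop (k + i)] with j hj hθj
    exact Set.disjoint_left.1 (disjoint_chains_chainsFrom (by omega)) hi (chainsFrom_anti hj hθj)
  obtain ⟨j, hj, hkj⟩ := (hev.and (Filter.eventually_ge_atTop k)).exists
  obtain ⟨θ, hθ⟩ := (natCast_le_maxChain_iff (α := α) (hk.trans hkj)).1 (h ▸ le_top)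
  exact hj θ (chainsFrom_anti hkj hθ) hθ

theorem mk_chainsFrom_congr (hk : 1 ≤ k) (h : ∀ j, k ≤ j → #(α.chains j) = #(β.chains j)) :
    #(α.chainsFrom k) = #(β.chainsFrom k) := by
  have hdisj : ∀ α : SymInv X, Pairwise (Function.onFun Disjoint fun i => α.chains (k + i)) :=
    fun α i j hij => disjoint_chains (by omega) (by omega) (by omega)
  refine lift_injective ?_
  rw [chainsFrom, chainsFrom, mk_iUnion_eq_sum_mk_lift (hdisj α),
    mk_iUnion_eq_sum_mk_lift (hdisj β)]
  exact congrArg Cardinal.sum (funext fun i => h (k + i) (Nat.le_add_right k i))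

theorem maxChain_congr (h : ∀ k, 1 ≤ k → #(α.chainsFrom k) = #(β.chainsFrom k)) :
    α.maxChain = β.maxChain := by
  refine ENat.eq_of_forall_natCast_le_iff fun k => ?_
  rcases k.eq_zero_or_pos with rfl | hk
  · exact iff_of_true zero_le zero_le
  · simp only [natCast_le_maxChain_iff hk, ← Set.nonempty_coe_sort, ← mk_ne_zero_iff, h k hk]

theorem bddAbove_mk_chains_eq_aleph0 (hα : α.maxChain ≠ ⊤) :
    BddAbove {m : ℕ | 1 ≤ m ∧ (m : ℕ∞) ≤ α.maxChain ∧ #(α.chains m) = ℵ₀} := by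
  lift α.maxChain to ℕ using hα with K hK
  exact ⟨K, fun m hm => Nat.cast_le.1 hm.2.1⟩

theorem exists_chains_infinite (hα : α.maxChain ≠ ⊤) (hk : 1 ≤ k)
    (h : (α.chainsFrom k).Infinite) : ∃ j, k ≤ j ∧ (α.chains j).Infinite := by
  by_contra! hfin
  lift α.maxChain to ℕ using hα with K hK
  refine h (((Set.finite_Icc k K).biUnion fun j hj => hfin j hj.1).subset fun θ hθ => ?_)
  obtain ⟨i, hi⟩ := Set.mem_iUnion.1 hθ
  have hiK := (natCast_le_maxChain_iff (by omega)).2 ⟨θ, chains_subset_chainsFrom le_rfl hi⟩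
  rw [← hK, Nat.cast_le] at hiK
  exact Set.mem_biUnion ⟨Nat.le_add_right k i, hiK⟩ hi

variable [Countable X]

theorem mk_chainsFrom_eq_aleph0 (hk : 1 ≤ k) (h : (α.chainsFrom k).Infinite) :
    #(α.chainsFrom k) = ℵ₀ := by
  have := (countable_chainsFrom (α := α) hk).to_subtype
  have := h.to_subtype
  exact mk_eq_aleph0 _

theorem le_maxInfChain_iff (hα : α.maxChain ≠ ⊤) (hk : 1 ≤ k) :
    k ≤ α.maxInfChain ↔ (α.chainsFrom k).Infinite := by
  have hbdd := bddAbove_mk_chains_eq_aleph0 hα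
  constructor
  · intro h
    have hne : α.maxInfChain ≠ 0 := by omega
    have hmem := Nat.sSup_mem (Set.nonempty_iff_ne_empty.2 fun he =>
      hne (by rw [maxInfChain, he, csSup_empty]; rfl)) hbdd
    have hinf : (α.chains α.maxInfChain).Infinite :=
      Set.infinite_coe_iff.1 (infinite_iff.2 hmem.2.2.ge)
    exact hinf.mono (chains_subset_chainsFrom h)
  · intro h
    obtain ⟨j, hkj, hj⟩ := exists_chains_infinite hα hk h
    have hle := (natCast_le_maxChain_iff (hk.trans hkj)).2
      (hj.nonempty.mono (chains_subset_chainsFrom le_rfl))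
    have := (countable_chains (α := α) (hk.trans hkj)).to_subtype
    have := hj.to_subtype
    exact hkj.trans (le_csSup hbdd ⟨hk.trans hkj, hle, mk_eq_aleph0 _⟩)

theorem maxInfChain_congr (hα : α.maxChain ≠ ⊤)
    (h : ∀ k, 1 ≤ k → #(α.chainsFrom k) = #(β.chainsFrom k)) :
    α.maxInfChain = β.maxInfChain := by
  refine eq_of_forall_le_iff fun k => ?_
  rcases k.eq_zero_or_pos with rfl | hk
  · exact iff_of_true (Nat.zero_le _) (Nat.zero_le _)
  · rw [le_maxInfChain_iff hα hk, le_maxInfChain_iff (maxChain_congr h ▸ hα) hk,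
      ← Set.infinite_coe_iff, ← Set.infinite_coe_iff, infinite_iff, infinite_iff, h k hk]

theorem forall_mk_chainsFrom_eq_iff :
    (∀ k, 1 ≤ k → #(α.chainsFrom k) = #(β.chainsFrom k)) ↔
      α.maxChain = β.maxChain ∧ ∀ K : ℕ, 1 ≤ K → α.maxChain = (K : ℕ∞) →
        α.maxInfChain = β.maxInfChain ∧
          ∀ k : ℕ, α.maxInfChain + 1 ≤ k → k ≤ K → #(α.chains k) = #(β.chains k) := by
  constructor
  · intro h
    refine ⟨maxChain_congr h, fun K _ hK => ?_⟩
    have hα : α.maxChain ≠ ⊤ := hK ▸ ENat.natCast_ne_top K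
    have hm := maxInfChain_congr hα h
    refine ⟨hm, fun k hk _ => ?_⟩
    have hk1 : 1 ≤ k := by omega
    refine mk_chains_eq_of_mk_chainsFrom_eq hk1 (h k hk1) (h _ k.succ_pos) ?_
    rw [← Set.not_infinite, ← le_maxInfChain_iff (maxChain_congr h ▸ hα) hk1]
    omega
  · rintro ⟨hmax, hchains⟩ k hk
    have mk_eq_of_infinite : (α.chainsFrom k).Infinite → (β.chainsFrom k).Infinite →
        #(α.chainsFrom k) = #(β.chainsFrom k) := fun hα hβ =>
      (mk_chainsFrom_eq_aleph0 hk hα).trans (mk_chainsFrom_eq_aleph0 hk hβ).symm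
    by_cases hα : α.maxChain = ⊤
    · exact mk_eq_of_infinite (chainsFrom_infinite hk hα) (chainsFrom_infinite hk (hmax ▸ hα))
    obtain ⟨K, hK⟩ := ENat.ne_top_iff_exists.1 hα
    have chainsFrom_empty : ∀ j, K < j → α.chainsFrom j = ∅ ∧ β.chainsFrom j = ∅ := fun j hj =>
      have hlt : α.maxChain < j := hK ▸ Nat.cast_lt.2 hj
      ⟨chainsFrom_eq_empty (by omega) hlt, chainsFrom_eq_empty (by omega) (hmax ▸ hlt)⟩
    rcases lt_or_ge K k with hKk | hkK
    · rw [(chainsFrom_empty k hKk).1, (chainsFrom_empty k hKk).2]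
    obtain ⟨hm, hΘ⟩ := hchains K (hk.trans hkK) hK.symm
    rcases le_or_gt k α.maxInfChain with hkm | hmk
    · exact mk_eq_of_infinite ((le_maxInfChain_iff hα hk).1 hkm)
        ((le_maxInfChain_iff (hmax ▸ hα) hk).1 (hm ▸ hkm))
    · refine mk_chainsFrom_congr hk fun j hj => ?_
      rcases le_or_gt j K with hjK | hKj
      · exact hΘ j (by omega) hjK
      · obtain ⟨hαj, hβj⟩ := chainsFrom_empty j hKj
        rw [Set.subset_eq_empty (chains_subset_chainsFrom le_rfl) hαj,
          Set.subset_eq_empty (chains_subset_chainsFrom le_rfl) hβj]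

end ChainInvariants

section Necessity

variable {X : Type*} {α β γ δ : SymInv X}

universe u in
theorem finite_iff_of_mk_eq {M N : Type u} {s : Set M} {t : Set N} (h : #s = #t) :
    s.Finite ↔ t.Finite := by
  rw [← lt_aleph0_iff_set_finite, ← lt_aleph0_iff_set_finite, h]

theorem Intertwines.mk_rightRays_eq (h : Intertwines α β γ) (h' : Intertwines β α δ)
    (hfin : α.doubleRays.Finite) : #α.rightRays = #β.rightRays := by
  have hsum := h.mk_rightRays_union_doubleRays_le.antisymm h'.mk_rightRays_union_doubleRays_le
  rw [mk_union_of_disjoint disjoint_rightRays_doubleRays,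
    mk_union_of_disjoint disjoint_rightRays_doubleRays,
    h'.mk_doubleRays_le.antisymm h.mk_doubleRays_le] at hsum
  exact Cardinal.eq_of_add_eq_add_right hsum (lt_aleph0_iff_set_finite.2 hfin)

theorem Intertwines.mk_chainsFrom_eq (h : Intertwines α β γ) (h' : Intertwines β α δ)
    (hfin : α.leftRays.Finite) {k : ℕ} (hk : 1 ≤ k) : #(α.chainsFrom k) = #(β.chainsFrom k) := by
  have hsum := (h.mk_leftRays_union_chainsFrom_le hk).antisymm
    (h'.mk_leftRays_union_chainsFrom_le hk)
  rw [mk_union_of_disjoint (disjoint_leftRays_chainsFrom hk),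
    mk_union_of_disjoint (disjoint_leftRays_chainsFrom hk),
    h'.mk_leftRays_le.antisymm h.mk_leftRays_le] at hsum
  exact Cardinal.eq_of_add_eq_add_left hsum (lt_aleph0_iff_set_finite.2 hfin)

end Necessity

end SymInv

theorem mainTheorem1 {X : Type*} [Countable X] (α β : SymInv X) :
    CConj α β ↔
      ((∀ k : ℕ, 1 ≤ k → #(α.cycles k) = #(β.cycles k)) ∧
          #α.doubleRays = #β.doubleRays ∧ #α.leftRays = #β.leftRays) ∧
        (α.doubleRays.Finite → #α.rightRays = #β.rightRays) ∧
        (α.leftRays.Finite →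
          α.maxChain = β.maxChain ∧
            ∀ K : ℕ, 1 ≤ K → α.maxChain = (K : ℕ∞) →
              α.maxInfChain = β.maxInfChain ∧
                ∀ k : ℕ, α.maxInfChain + 1 ≤ k → k ≤ K →
                  #(α.chains k) = #(β.chains k)) := by
  rw [SymInv.cConj_iff, ← SymInv.forall_mk_chainsFrom_eq_iff]
  constructor
  · rintro ⟨⟨γ, hγ⟩, δ, hδ⟩
    exact ⟨⟨fun k hk => (hγ.mk_cycles_le hk).antisymm (hδ.mk_cycles_le hk),
      hγ.mk_doubleRays_le.antisymm hδ.mk_doubleRays_le,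
      hγ.mk_leftRays_le.antisymm hδ.mk_leftRays_le⟩,
      hγ.mk_rightRays_eq hδ, fun hfin k hk => hγ.mk_chainsFrom_eq hδ hfin hk⟩
  · rintro ⟨⟨hΔ, hΩ, hΛ⟩, hΥ, hΘ⟩
    have hΩfin := SymInv.finite_iff_of_mk_eq hΩ
    have hΛfin := SymInv.finite_iff_of_mk_eq hΛ
    exact ⟨SymInv.exists_intertwines_of_mk_eq hΔ hΩ hΛ (fun h => hΥ (hΩfin.2 h))
        fun h => hΘ (hΛfin.2 h),
      SymInv.exists_intertwines_of_mk_eq (fun k hk => (hΔ k hk).symm) hΩ.symm hΛ.symm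
        (fun h => (hΥ h).symm) fun h k hk => (hΘ h k hk).symm⟩
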